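/- Let $\Sigma$ be an oriented smooth surface (a Hausdorff, second countable, oriented smooth $2$-manifold without boundary). Let $\mathcal F\Sigma$ be the group of orientation-preserving self-diffeomorphisms of $\Sigma$ with the compact-open topology, and $M(\Sigma)=\pi_0(\mathcal F\Sigma)$ the mapping class group, with product $[f][g]=[f\circ g]$. Two smoothly embedded, unoriented simple closed curves $c,c'$ in $\Sigma$ are isotopic if $c'=h(c)$ for some $h$ in the path component of the identity in $\mathcal F\Sigma$; let $D(\Sigma)$ be the set of isotopy classes. A positive (negative) Dehn twist about $c$ is a diffeomorphism $t\in\mathcal F\Sigma$ of the following form: there are an orientation-preserving diffeomorphism $\phi$ from an open neighbourhood $U$ of $c$ onto $\{z\in\mathbb C: 1<|z|<2\}$ carrying $c$ onto $\{|z|=3/2\}$, and a smooth $f:\mathbb R\to\mathbb R$ equal to $1$ near $1$ and to $2$ near $2$, such that $t$ is the identity outside $U$ and is $(r,\theta)\mapsto(r,\theta+2\pi f(r))$ (respectively $(r,\theta)\mapsto(r,\theta-2\pi f(r))$) on $U$ in the polar coordinates given by $\phi$. Then every simple closed curve has positive and negative Dehn twists, and the following are well defined (independent of all choices): the operations $[x]\rhd[y]=[t_y^+(x)]$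 and $[x]\unrhd[y]=[t_y^-(x)]$ on $D(\Sigma)$, where $t_y^{\pm}$ is any positive, respectively negative, Dehn twist about $y$; the map $[q]\cdot[h]=[h(q)]$ from $D(\Sigma)\times M(\Sigma)$ to $D(\Sigma)$; and the map $\ell:D(\Sigma)\to M(\Sigma)$ sending $[c]$ to the mapping class of any positive Dehn twist about $c$. With these, $D(\Sigma)$ is a quandle, and $(D(\Sigma),M(\Sigma),\ell,\cdot)$ is an augmented quandle, where for this right action products in $M(\Sigma)$ are read from left to right (that is, $M(\Sigma)$ is replaced by its opposite group): $\cdot$ is a right action by quandle automorphisms, $q\cdot\ell(q)=q$ and $\ell(q\cdot\gamma)=\gamma^{-1}\ell(q)\gamma$ in that group. Equivalently to the last identity, $t_{h(c)}=h\,t_c\,h^{-1}$ in $M(\Sigma)$ with the product $[f][g]=[f\circ g]$, for every simple closed curve $c$ and every $h\in\mathcal F\Sigma$. -/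

import Mathlib

open Set Topology
open scoped Manifold ContDiff Quandles

noncomputable section

/-- An oriented smooth surface (without boundary), given by an oriented atlas: a smooth real
two-dimensional manifold, with charts in the real plane `ℂ = ℝ²`, all of whose changes of
coordinates are (real) smooth with positive Jacobian determinant.  The Hausdorff property and second
countability are separate hypotheses. -/
class OrientedSurface (S : Type*) [TopologicalSpace S] [ChartedSpace ℂ S] : Prop
    extends IsManifold 𝓘(ℝ, ℂ) ∞ S where
  det_pos : ∀ e ∈ atlas ℂ S, ∀ e' ∈ atlas ℂ S, ∀ z ∈ (e.symm.trans e').source,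
    0 < (fderiv ℝ (e.symm.trans e') z).det

/-- The Jacobian determinant of `f` at `x`.  The derivative is taken in the preferred charts at `x`
and at `f x`, which belong to the atlas; so for oriented surfaces the sign says whether `f`
preserves the orientation at `x`. -/
def surfaceJacobian {S T : Type*} [TopologicalSpace S] [ChartedSpace ℂ S] [TopologicalSpace T]
    [ChartedSpace ℂ T] (f : S → T) (x : S) : ℝ :=
  ContinuousLinearMap.det (R := ℝ) (M := ℂ) (mfderiv 𝓘(ℝ, ℂ) 𝓘(ℝ, ℂ) f x)

section Diffeos

variable (S : Type*) [TopologicalSpace S] [ChartedSpace ℂ S]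

/-- The orientation-preserving self-diffeomorphisms of a surface. -/
structure OrientedDiffeo where
  toDiffeo : Diffeomorph 𝓘(ℝ, ℂ) 𝓘(ℝ, ℂ) S S ∞
  jacobian_pos : ∀ x, 0 < surfaceJacobian toDiffeo x

variable {S}

namespace OrientedDiffeo

instance : CoeFun (OrientedDiffeo S) (fun _ => S → S) := ⟨fun f => f.toDiffeo⟩

theorem ext' {f g : OrientedDiffeo S} (h : ∀ x, f x = g x) : f = g := by
  cases f; cases g
  congr
  exact Diffeomorph.ext h

theorem mdifferentiable (f : Diffeomorph 𝓘(ℝ, ℂ) 𝓘(ℝ, ℂ) S S ∞) (x : S) :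
    MDifferentiableAt 𝓘(ℝ, ℂ) 𝓘(ℝ, ℂ) f x :=
  f.mdifferentiable (by simp) x

theorem jacobian_comp (f g : Diffeomorph 𝓘(ℝ, ℂ) 𝓘(ℝ, ℂ) S S ∞) (x : S) :
    surfaceJacobian (f ∘ g) x = surfaceJacobian f (g x) * surfaceJacobian g x := by
  unfold surfaceJacobian
  rw [mfderiv_comp x (mdifferentiable f _) (mdifferentiable g _)]
  exact LinearMap.det_comp (M := ℂ) (A := ℝ) _ _

theorem jacobian_id (x : S) : surfaceJacobian (id : S → S) x = 1 := by
  unfold surfaceJacobian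
  rw [mfderiv_id]
  exact LinearMap.det_id (M := ℂ) (A := ℝ)

/-- Products are compositions: `(f * g) x = f (g x)`. -/
instance : Mul (OrientedDiffeo S) where
  mul f g := ⟨g.toDiffeo.trans f.toDiffeo, fun x => by
    rw [Diffeomorph.coe_trans, jacobian_comp]
    exact mul_pos (f.jacobian_pos _) (g.jacobian_pos _)⟩

instance : One (OrientedDiffeo S) where
  one := ⟨Diffeomorph.refl _ _ _, fun x => by
    rw [Diffeomorph.coe_refl, jacobian_id]; exact one_pos⟩

instance : Inv (OrientedDiffeo S) where
  inv f := ⟨f.toDiffeo.symm, fun x => by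
    have h := jacobian_comp f.toDiffeo f.toDiffeo.symm x
    rw [show (f.toDiffeo ∘ f.toDiffeo.symm : S → S) = id from
      funext f.toDiffeo.apply_symm_apply, jacobian_id] at h
    exact (pos_iff_pos_of_mul_pos (h ▸ one_pos)).1 (f.jacobian_pos _)⟩

theorem mul_apply (f g : OrientedDiffeo S) (x : S) : (f * g) x = f (g x) := rfl

theorem one_apply (x : S) : (1 : OrientedDiffeo S) x = x := rfl

theorem inv_apply_self (f : OrientedDiffeo S) (x : S) : f⁻¹ (f x) = x :=
  f.toDiffeo.symm_apply_apply x

instance : Group (OrientedDiffeo S) where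
  mul_assoc _ _ _ := ext' fun _ => rfl
  one_mul _ := ext' fun _ => rfl
  mul_one _ := ext' fun _ => rfl
  inv_mul_cancel f := ext' fun x => inv_apply_self f x

/-- The underlying continuous map. -/
def toContinuousMap (f : OrientedDiffeo S) : C(S, S) := ⟨f, f.toDiffeo.continuous⟩

/-- The compact-open topology. -/
instance : TopologicalSpace (OrientedDiffeo S) :=
  TopologicalSpace.induced toContinuousMap inferInstance

theorem continuous_toContinuousMap : Continuous (toContinuousMap : OrientedDiffeo S → C(S, S)) :=
  continuous_induced_dom

theorem continuous_mul_left (f : OrientedDiffeo S) : Continuous (fun g => f * g) :=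
  continuous_induced_rng.2 <|
    (ContinuousMap.continuous_postcomp f.toContinuousMap).comp continuous_toContinuousMap

theorem continuous_mul_right (f : OrientedDiffeo S) : Continuous (fun g => g * f) :=
  continuous_induced_rng.2 <|
    (ContinuousMap.continuous_precomp f.toContinuousMap).comp continuous_toContinuousMap

theorem joined_mul {f f' g g' : OrientedDiffeo S} (h : Joined f f') (k : Joined g g') :
    Joined (f * g) (f' * g') :=
  (h.map (continuous_mul_right g)).trans (k.map (continuous_mul_left f'))

theorem joined_inv {f g : OrientedDiffeo S} (h : Joined f g) : Joined f⁻¹ g⁻¹ := by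
  have := joined_mul (joined_mul (Joined.refl f⁻¹) h) (Joined.refl g⁻¹)
  simpa using this.symm

end OrientedDiffeo

variable (S)

/-- The mapping class group: the path components of the group of orientation-preserving
self-diffeomorphisms in the compact-open topology.  Products are induced by composition:
`[f] * [g] = [f ∘ g]`. -/
def MappingClassGroup := ZerothHomotopy (OrientedDiffeo S)

variable {S}

namespace MappingClassGroup

/-- The mapping class of a diffeomorphism. -/
def mk (f : OrientedDiffeo S) : MappingClassGroup S :=
  Quotient.mk (pathSetoid (OrientedDiffeo S)) f

instance : Mul (MappingClassGroup S) where
  mul := Quotient.map₂ (· * ·) fun _ _ h _ _ k => OrientedDiffeo.joined_mul h k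

instance : One (MappingClassGroup S) := ⟨mk 1⟩

instance : Inv (MappingClassGroup S) where
  inv := Quotient.map (·⁻¹) fun _ _ h => OrientedDiffeo.joined_inv h

instance : Group (MappingClassGroup S) where
  mul_assoc := by
    rintro ⟨a⟩ ⟨b⟩ ⟨c⟩; exact congrArg mk (mul_assoc a b c)
  one_mul := by rintro ⟨a⟩; exact congrArg mk (one_mul a)
  mul_one := by rintro ⟨a⟩; exact congrArg mk (mul_one a)
  inv_mul_cancel := by rintro ⟨a⟩; exact congrArg mk (inv_mul_cancel a)

end MappingClassGroup

end Diffeos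

section Curves

variable (S : Type*) [TopologicalSpace S] [ChartedSpace ℂ S]

/-- An (unoriented, smooth) simple closed curve: a subset that is the image of a smoothly embedded
circle `ℝ / ℤ`, that is, of a smooth regular `1`-periodic parametrization that is injective on a
period. -/
structure SimpleClosedCurve where
  carrier : Set S
  exists_param : ∃ γ : ℝ → S, ContMDiff 𝓘(ℝ, ℝ) 𝓘(ℝ, ℂ) ∞ γ ∧ Function.Periodic γ 1 ∧
    InjOn γ (Ico 0 1) ∧ (∀ t, mfderiv 𝓘(ℝ, ℝ) 𝓘(ℝ, ℂ) γ t ≠ 0) ∧ range γ = carrier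

variable {S}

namespace SimpleClosedCurve

theorem ext' {c d : SimpleClosedCurve S} (h : c.carrier = d.carrier) : c = d := by
  cases c; cases d; congr

/-- The image `h(c)` of a curve `c` under a diffeomorphism `h`. -/
def map (h : OrientedDiffeo S) (c : SimpleClosedCurve S) : SimpleClosedCurve S where
  carrier := h '' c.carrier
  exists_param := by
    obtain ⟨γ, hγ, hp, hi, hd, hr⟩ := c.exists_param
    refine ⟨h ∘ γ, h.toDiffeo.contMDiff.comp hγ, fun t => congrArg h (hp t),
      h.toDiffeo.injective.comp_injOn hi, fun t ht => hd t ?_, by rw [range_comp, hr]⟩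
    have hg : MDifferentiableAt 𝓘(ℝ, ℝ) 𝓘(ℝ, ℂ) γ t := hγ.mdifferentiable (by simp) t
    have hh := OrientedDiffeo.mdifferentiable h.toDiffeo (γ t)
    rw [mfderiv_comp t hh hg] at ht
    refine ContinuousLinearMap.ext fun v => ?_
    have hv := DFunLike.congr_fun ht v
    apply (h.toDiffeo.mfderivToContinuousLinearEquiv (by simp) (γ t)).injective
    exact hv.trans (map_zero _).symm

/-- Two simple closed curves are isotopic if some isotopy of the surface, that is, a path of
orientation-preserving diffeomorphisms that starts at the identity, carries one to the other. -/
def Isotopic (c d : SimpleClosedCurve S) : Prop :=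
  ∃ h : OrientedDiffeo S, Joined 1 h ∧ c.map h = d

theorem map_mul (f g : OrientedDiffeo S) (c : SimpleClosedCurve S) :
    c.map (f * g) = (c.map g).map f :=
  ext' (image_comp f g c.carrier)

theorem map_one (c : SimpleClosedCurve S) : c.map 1 = c := ext' (image_id c.carrier)

variable (S) in
/-- Isotopy is an equivalence relation. -/
def isotopySetoid : Setoid (SimpleClosedCurve S) where
  r := Isotopic
  iseqv :=
    { refl := fun c => ⟨1, Joined.refl 1, map_one c⟩
      symm := by
        rintro c d ⟨h, hj, rfl⟩
        refine ⟨h⁻¹, by simpa using OrientedDiffeo.joined_inv hj, ?_⟩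
        rw [← map_mul, inv_mul_cancel, map_one]
      trans := by
        rintro c d e ⟨h, hj, rfl⟩ ⟨k, kj, rfl⟩
        exact ⟨k * h, by simpa using OrientedDiffeo.joined_mul kj hj, map_mul k h c⟩ }

end SimpleClosedCurve

variable (S) in
/-- The set of isotopy classes of simple closed curves, which underlies the Dehn quandle. -/
def DehnQuandle := Quotient (SimpleClosedCurve.isotopySetoid S)

/-- The isotopy class of a simple closed curve. -/
def DehnQuandle.mk (c : SimpleClosedCurve S) : DehnQuandle S :=
  Quotient.mk (SimpleClosedCurve.isotopySetoid S) c

/-- The diffeomorphism `φ` from its (open) source `U` onto the open annulus `{z | 1 < |z| < 2}`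
preserves the orientation and maps `c` onto the core circle `{z | |z| = 3 / 2}`. -/
structure IsBicollar (φ : OpenPartialHomeomorph S ℂ) (c : SimpleClosedCurve S) : Prop where
  target_eq : φ.target = {z : ℂ | 1 < ‖z‖ ∧ ‖z‖ < 2}
  smooth : ContMDiffOn 𝓘(ℝ, ℂ) 𝓘(ℝ, ℂ) ∞ φ φ.source
  smooth_symm : ContMDiffOn 𝓘(ℝ, ℂ) 𝓘(ℝ, ℂ) ∞ φ.symm φ.target
  jacobian_pos : ∀ x ∈ φ.source, 0 < surfaceJacobian φ x
  subset_source : c.carrier ⊆ φ.source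
  image_eq : φ '' c.carrier = {z : ℂ | ‖z‖ = 3 / 2}

/-- A smoothing of the radius function on `[1, 2]`: it equals `1` near `1` and `2` near `2`. -/
structure IsTwistProfile (f : ℝ → ℝ) : Prop where
  smooth : ContDiff ℝ ∞ f
  eq_one : ∀ᶠ r in 𝓝 1, f r = 1
  eq_two : ∀ᶠ r in 𝓝 2, f r = 2

open Classical in
/-- The twist `(r, θ) ↦ (r, θ + 2 π f(r))` in the annular coordinates `φ`, extended by the
identity. -/
def twistMap (φ : OpenPartialHomeomorph S ℂ) (f : ℝ → ℝ) (x : S) : S :=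
  if x ∈ φ.source then
    φ.symm (φ x * Complex.exp (((2 * Real.pi * f ‖φ x‖ : ℝ) : ℂ) * Complex.I))
  else x

/-- `t` is a (smoothed) positive Dehn twist about `c`. -/
def IsPositiveDehnTwist (t : OrientedDiffeo S) (c : SimpleClosedCurve S) : Prop :=
  ∃ φ f, IsBicollar φ c ∧ IsTwistProfile f ∧ ∀ x, t x = twistMap φ f x

/-- `t` is a (smoothed) negative Dehn twist about `c`, given by `(r, θ) ↦ (r, θ - 2 π f(r))`. -/
def IsNegativeDehnTwist (t : OrientedDiffeo S) (c : SimpleClosedCurve S) : Prop :=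
  ∃ φ f, IsBicollar φ c ∧ IsTwistProfile f ∧ ∀ x, t x = twistMap φ (fun r => -f r) x

end Curves

/-- `(Q, G, ℓ, ·)` is an augmented quandle: `·` is a right action of the group `G` on the quandle
`Q` by quandle homomorphisms, with `q · ℓ(q) = q` and `ℓ(q · g) = g⁻¹ ℓ(q) g`.  (The quandle
operation written `x ▷ y` in right-handed notation is Mathlib's `y ◃ x`.) -/
structure IsAugmentedQuandle (Q G : Type*) [Quandle Q] [Group G] (ℓ : Q → G) (act : Q → G → Q) :
    Prop where
  act_one : ∀ q, act q 1 = q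
  act_mul : ∀ q g h, act q (g * h) = act (act q g) h
  act_hom : ∀ x y g, act (x ◃ y) g = act x g ◃ act y g
  act_hom_inv : ∀ x y g, act (x ◃⁻¹ y) g = act x g ◃⁻¹ act y g
  act_self : ∀ q, act q (ℓ q) = q
  aug_act : ∀ q g, ℓ (act q g) = g⁻¹ * ℓ q * g

end

set_option linter.unusedSectionVars false

noncomputable section

/-! The algebra rests on two facts. Two positive twists about one curve lie in the same path
component (`joined_of_isPositiveDehnTwist`), and conjugating a twist about c by h gives a twist
about h(c), since h transports the collar (`IsPositiveDehnTwist.conj`). Hence the twist class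
depends only on the isotopy class of the curve and is equivariant for conjugation
(`twistClass_smul`). Together with t_c(c) = c this yields the axioms of a quandle and of an
augmented quandle. A negative twist is the inverse of a positive twist in the same collar.

Existence of collars (`SimpleClosedCurve.exists_isBicollar`): local maps to the plane that carry the
curve to the core circle by a prescribed parametrization are glued by a partition of unity. Their
derivatives agree on the tangent of the curve, and the determinant is affine on linear maps with a
prescribed value at one nonzero vector (`det_sum_smul`), so the glued map still has positive
Jacobian along the curve. It is therefore a chart near this compact set, and a radial rescaling
makes its image the standard annulus.

Uniqueness of twists: given collars φ₀ and φ₁, the profiles are first deformed to thin steps at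
radius 3/2 (`IsBicollar.joined_of_isStep`). The transition ψ = φ₁ ∘ φ₀⁻¹ preserves the core circle
and lifts there to a map θ of the line with derivative of constant sign. If θ increases, it has
degree one, so ψ(z) = z exp(g(z)) near the circle, and z exp(s g(z)) joins the identity to ψ. On the
circle this is the straight-line homotopy of lifts. Its Jacobian there is a positive factor times a
tangential and a radial factor, each affine in s and positive at s = 0 and s = 1
(`det_fderiv_mul_exp`). Compactness of [0, 1] × circle gives an annulus that serves all s
(`exists_isotopy_chart`), and the thin twists in the moving collar form a path
(`joined_of_twist_family`). If θ decreases, φ₁ is replaced by (9/4)/φ₁: this holomorphic change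
reverses the curve and swaps its sides, and positive twists remain positive (`twistMap_reverse`). -/

theorem det_complex (L : ℂ →L[ℝ] ℂ) :
    L.det = (L 1).re * (L Complex.I).im - (L Complex.I).re * (L 1).im := by
  rw [ContinuousLinearMap.det, ← LinearMap.det_toMatrix Complex.basisOneI, Matrix.det_fin_two]
  simp [LinearMap.toMatrix_apply, Complex.coe_basisOneI_repr]

/-! ### Jacobians of maps between surfaces -/

section Jacobian

variable {S T R : Type*} [TopologicalSpace S] [ChartedSpace ℂ S] [TopologicalSpace T]
    [ChartedSpace ℂ T] [TopologicalSpace R] [ChartedSpace ℂ R]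

theorem surfaceJacobian_comp {f : T → R} {g : S → T} {x : S}
    (hf : MDifferentiableAt 𝓘(ℝ, ℂ) 𝓘(ℝ, ℂ) f (g x))
    (hg : MDifferentiableAt 𝓘(ℝ, ℂ) 𝓘(ℝ, ℂ) g x) :
    surfaceJacobian (f ∘ g) x = surfaceJacobian f (g x) * surfaceJacobian g x := by
  unfold surfaceJacobian
  rw [mfderiv_comp x hf hg]
  exact LinearMap.det_comp (M := ℂ) (A := ℝ) _ _

theorem surfaceJacobian_congr {f g : S → T} {x : S} (h : f =ᶠ[𝓝 x] g) :
    surfaceJacobian f x = surfaceJacobian g x := by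
  unfold surfaceJacobian
  have := h.mfderiv_eq (I := 𝓘(ℝ, ℂ)) (I' := 𝓘(ℝ, ℂ))
  exact congrArg (ContinuousLinearMap.det (R := ℝ) (M := ℂ)) this

theorem surfaceJacobian_eq_fderiv (f : ℂ → ℂ) (z : ℂ) :
    surfaceJacobian f z = (fderiv ℝ f z).det := by
  unfold surfaceJacobian
  rw [mfderiv_eq_fderiv]
  rfl

/-- The derivative at y is taken in the preferred chart at y, so it is the derivative of a change of
coordinates of the atlas. This is where the orientation of the atlas enters. -/
theorem surfaceJacobian_chartAt_pos [OrientedSurface S] (x y : S) (hy : y ∈ (chartAt ℂ x).source) :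
    0 < surfaceJacobian (chartAt ℂ x) y := by
  have h1 : MDifferentiableAt 𝓘(ℝ, ℂ) 𝓘(ℝ, ℂ) (chartAt ℂ x) y :=
    mdifferentiableAt_atlas (chart_mem_atlas ℂ x) hy
  have := OrientedSurface.det_pos _ (chart_mem_atlas ℂ y) _ (chart_mem_atlas ℂ x)
    (chartAt ℂ y y) (by simp [hy])
  have key : @Eq (ℂ →L[ℝ] ℂ) (mfderiv 𝓘(ℝ, ℂ) 𝓘(ℝ, ℂ) (chartAt ℂ x) y)
      (fderiv ℝ ((chartAt ℂ y).symm.trans (chartAt ℂ x)) (chartAt ℂ y y)) := by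
    rw [h1.mfderiv]
    simp only [writtenInExtChartAt, extChartAt, mfld_simps, fderivWithin_univ]
    rfl
  unfold surfaceJacobian
  exact lt_of_lt_of_eq this (congrArg (ContinuousLinearMap.det (R := ℝ) (M := ℂ)) key).symm

theorem contDiffAt_comp_chartAt_symm [IsManifold 𝓘(ℝ, ℂ) ∞ S] {f : S → ℂ} {x y : S}
    (hf : ContMDiffAt 𝓘(ℝ, ℂ) 𝓘(ℝ, ℂ) ∞ f y) (hy : y ∈ (chartAt ℂ x).source) :
    ContDiffAt ℝ ∞ (f ∘ (chartAt ℂ x).symm) (chartAt ℂ x y) := by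
  rw [← contMDiffAt_iff_contDiffAt]
  have h1 : ContMDiffAt 𝓘(ℝ, ℂ) 𝓘(ℝ, ℂ) ∞ (chartAt ℂ x).symm (chartAt ℂ x y) :=
    contMDiffOn_chart_symm.contMDiffAt ((chartAt ℂ x).open_target.mem_nhds
      ((chartAt ℂ x).map_source hy))
  exact ContMDiffAt.comp (I' := 𝓘(ℝ, ℂ)) _ (by rwa [(chartAt ℂ x).left_inv hy]) h1

theorem comp_chartAt_symm_comp_eventuallyEq (f : S → ℂ) {x y : S}
    (hy : y ∈ (chartAt ℂ x).source) :
    (f ∘ (chartAt ℂ x).symm) ∘ chartAt ℂ x =ᶠ[𝓝 y] f := by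
  filter_upwards [(chartAt ℂ x).open_source.mem_nhds hy] with z hz
  simp [hz]

/-- The preferred chart at y may jump as y varies. Splitting off a factor of positive sign leaves a
determinant in one fixed chart, which is continuous in y. -/
theorem surfaceJacobian_eq_mul_chartAt [IsManifold 𝓘(ℝ, ℂ) ∞ S] {f : S → ℂ} {x y : S}
    (hf : MDifferentiableAt 𝓘(ℝ, ℂ) 𝓘(ℝ, ℂ) f y) (hy : y ∈ (chartAt ℂ x).source) :
    surfaceJacobian f y = (fderiv ℝ (f ∘ (chartAt ℂ x).symm) (chartAt ℂ x y)).det *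
      surfaceJacobian (chartAt ℂ x) y := by
  rw [← surfaceJacobian_congr (comp_chartAt_symm_comp_eventuallyEq f hy), surfaceJacobian_comp,
    surfaceJacobian_eq_fderiv]
  · refine MDifferentiableAt.comp (I' := 𝓘(ℝ, ℂ)) _ ?_
      (mdifferentiableAt_atlas_symm (chart_mem_atlas ℂ x) ((chartAt ℂ x).map_source hy))
    rwa [(chartAt ℂ x).left_inv hy]
  · exact (mdifferentiableAt_atlas (chart_mem_atlas ℂ x) hy)

theorem continuousAt_det_fderiv {f : ℂ → ℂ} {z : ℂ} (hf : ContDiffAt ℝ ∞ f z) :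
    ContinuousAt (fun w => (fderiv ℝ f w).det) z :=
  ContinuousLinearMap.continuous_det.continuousAt.comp (hf.continuousAt_fderiv (by simp))

/-- A positive Jacobian at a point is positive nearby. -/
theorem eventually_surfaceJacobian_pos [OrientedSurface S] {f : S → ℂ} {x : S}
    (hf : ContMDiffAt 𝓘(ℝ, ℂ) 𝓘(ℝ, ℂ) ∞ f x) (h : 0 < surfaceJacobian f x) :
    ∀ᶠ y in 𝓝 x, 0 < surfaceJacobian f y := by
  have hx := mem_chart_source ℂ x
  rw [surfaceJacobian_eq_mul_chartAt (hf.mdifferentiableAt (by simp)) hx,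
    mul_pos_iff_of_pos_right (surfaceJacobian_chartAt_pos x x hx)] at h
  have h1 : ContinuousAt (chartAt ℂ x) x := (chartAt ℂ x).continuousAt hx
  have h2 := (continuousAt_det_fderiv (contDiffAt_comp_chartAt_symm hf hx)).comp h1
  have h3 : ∀ᶠ y in 𝓝 x, ContMDiffAt 𝓘(ℝ, ℂ) 𝓘(ℝ, ℂ) 1 f y :=
    (contMDiffAt_iff_contMDiffAt_nhds (by simp)).1 (hf.of_le (by simp))
  filter_upwards [h2.eventually (lt_mem_nhds h), h3,
    (chartAt ℂ x).open_source.mem_nhds hx] with y hy1 hy2 hy3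
  rw [surfaceJacobian_eq_mul_chartAt (hy2.mdifferentiableAt (by simp)) hy3]
  exact mul_pos hy1 (surfaceJacobian_chartAt_pos x y hy3)

/-- Smooth partial inverses have inverse Jacobians. -/
theorem surfaceJacobian_symm_mul (φ : OpenPartialHomeomorph S T)
    (h : ContMDiffOn 𝓘(ℝ, ℂ) 𝓘(ℝ, ℂ) ∞ φ φ.source)
    (h' : ContMDiffOn 𝓘(ℝ, ℂ) 𝓘(ℝ, ℂ) ∞ φ.symm φ.target) {x : S} (hx : x ∈ φ.source) :
    surfaceJacobian φ.symm (φ x) * surfaceJacobian φ x = 1 := by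
  rw [← surfaceJacobian_comp, ← OrientedDiffeo.jacobian_id x]
  · apply surfaceJacobian_congr
    filter_upwards [φ.open_source.mem_nhds hx] with z hz
    simp [hz]
  · exact (h'.contMDiffAt (φ.open_target.mem_nhds (φ.map_source hx))).mdifferentiableAt (by simp)
  · exact (h.contMDiffAt (φ.open_source.mem_nhds hx)).mdifferentiableAt (by simp)

end Jacobian

/-! ### Radial rotations and twist diffeomorphisms -/

/-- The determinant of the real derivative of a map `z ↦ z * m ‖z‖`. -/
theorem hasFDerivAt_mul_radial {m : ℝ → ℂ} {m' : ℂ} {z : ℂ} (hz : z ≠ 0)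
    (hm : HasDerivAt m m' ‖z‖) :
    DifferentiableAt ℝ (fun w : ℂ => w * m ‖w‖) z ∧
    (fderiv ℝ (fun w : ℂ => w * m ‖w‖) z).det =
      ‖m ‖z‖‖ ^ 2 + ‖z‖ * (m ‖z‖ * (starRingEnd ℂ) m').re := by
  have hz' : ‖z‖ ≠ 0 := by simpa using hz
  have hn : HasFDerivAt (fun w : ℂ => ‖w‖) ((‖z‖⁻¹) • innerSL ℝ z) z := by
    have := (hasStrictFDerivAt_norm_sq z).hasFDerivAt.sqrt (by positivity)
    simp only [Real.sqrt_sq (norm_nonneg _)] at this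
    have e : (‖z‖⁻¹) • innerSL ℝ z = (1 / (2 * ‖z‖)) • 2 • innerSL ℝ z := by
      rw [← Nat.cast_smul_eq_nsmul ℝ, smul_smul]
      congr 1
      push_cast
      field_simp
    rwa [e]
  have := (hasFDerivAt_id (𝕜 := ℝ) z).mul (hm.hasFDerivAt.comp z hn)
  refine ⟨this.differentiableAt, ?_⟩
  have h2 := this.fderiv
  simp only [id] at h2
  erw [h2, det_complex]
  have h3 : ‖z‖ ^ 2 = z.re ^ 2 + z.im ^ 2 := by rw [Complex.sq_norm, Complex.normSq_apply]; ring
  rw [Complex.sq_norm, Complex.normSq_apply]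
  simp
  field_simp
  rw [h3]
  linear_combination ((m ‖z‖).re ^ 2 + (m ‖z‖).im ^ 2) * h3

section

/-- The rotation `(r, θ) ↦ (r, θ + 2 π f(r))` of the plane. -/
def radialRotation (f : ℝ → ℝ) (z : ℂ) : ℂ :=
  z * Complex.exp (((2 * Real.pi * f ‖z‖ : ℝ) : ℂ) * Complex.I)

@[simp] theorem norm_radialRotation (f : ℝ → ℝ) (z : ℂ) : ‖radialRotation f z‖ = ‖z‖ := by
  rw [radialRotation, norm_mul, Complex.norm_exp_ofReal_mul_I, mul_one]

theorem radialRotation_neg_radialRotation (f : ℝ → ℝ) (z : ℂ) :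
    radialRotation (fun r => -f r) (radialRotation f z) = z := by
  rw [radialRotation, norm_radialRotation, radialRotation, mul_assoc, ← Complex.exp_add]
  have : (((2 * Real.pi * f ‖z‖ : ℝ) : ℂ) * Complex.I) +
    (((2 * Real.pi * -f ‖z‖ : ℝ) : ℂ) * Complex.I) = 0 := by push_cast; ring
  rw [this, Complex.exp_zero, mul_one]

theorem radialRotation_eq_self {f : ℝ → ℝ} {z : ℂ} {n : ℤ} (h : f ‖z‖ = n) :
    radialRotation f z = z := by
  rw [radialRotation, h]
  have : (((2 * Real.pi * n : ℝ) : ℂ) * Complex.I) = n * (2 * Real.pi * Complex.I) := by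
    push_cast; ring
  rw [this, Complex.exp_int_mul_two_pi_mul_I, mul_one]

theorem contDiffAt_radialRotation {f : ℝ → ℝ} {z : ℂ} (hz : z ≠ 0)
    (hf : ContDiffAt ℝ ∞ f ‖z‖) : ContDiffAt ℝ ∞ (radialRotation f) z := by
  have h1 : ContDiffAt ℝ ∞ (fun w : ℂ => f ‖w‖) z := hf.comp z (contDiffAt_norm ℝ hz)
  have h2 : ContDiffAt ℝ ∞ (fun w : ℂ => ((2 * Real.pi * f ‖w‖ : ℝ) : ℂ)) z :=
    Complex.ofRealCLM.contDiff.contDiffAt.comp z (contDiffAt_const.mul h1)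
  exact contDiffAt_id.mul (h2.mul contDiffAt_const).cexp

/-- For a unimodular factor m, the product of m with the conjugate of m' is purely imaginary, so
only |m|² = 1 survives in the radial formula. -/
theorem det_fderiv_radialRotation {f : ℝ → ℝ} {z : ℂ} (hz : z ≠ 0)
    (hf : DifferentiableAt ℝ f ‖z‖) : (fderiv ℝ (radialRotation f) z).det = 1 := by
  have h1 := (((hf.hasDerivAt.const_mul (2 * Real.pi)).ofReal_comp).mul_const Complex.I).cexp
  have h2 := (hasFDerivAt_mul_radial hz h1).2
  refine h2.trans ?_
  rw [Complex.norm_exp_ofReal_mul_I, map_mul, map_mul, ← mul_assoc, Complex.mul_conj]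
  simp

/-- `{z | a ≤ |z| ≤ b}` -/
def closedAnnulus (a b : ℝ) : Set ℂ := {z | a ≤ ‖z‖ ∧ ‖z‖ ≤ b}

theorem isCompact_closedAnnulus (a b : ℝ) : IsCompact (closedAnnulus a b) := by
  refine (isCompact_closedBall (0 : ℂ) b).of_isClosed_subset ?_ fun z hz => by simpa using hz.2
  exact (isClosed_le continuous_const continuous_norm).inter
    (isClosed_le continuous_norm continuous_const)

variable {S : Type*} [TopologicalSpace S] [ChartedSpace ℂ S]

/-- An orientation-preserving diffeomorphism from an open part of the surface to one of the
plane. -/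
structure IsOrientedChart (φ : OpenPartialHomeomorph S ℂ) : Prop where
  smooth : ContMDiffOn 𝓘(ℝ, ℂ) 𝓘(ℝ, ℂ) ∞ φ φ.source
  smooth_symm : ContMDiffOn 𝓘(ℝ, ℂ) 𝓘(ℝ, ℂ) ∞ φ.symm φ.target
  jacobian_pos : ∀ x ∈ φ.source, 0 < surfaceJacobian φ x

/-- Conditions under which the twist with profile `f` is supported in the annulus
`a ≤ |z| ≤ b` of the chart `φ`. -/
structure IsTwistable (φ : OpenPartialHomeomorph S ℂ) (f : ℝ → ℝ) (a b : ℝ) : Prop where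
  pos : 0 < a
  subset : closedAnnulus a b ⊆ φ.target
  smooth : ∀ r, 0 < r → ContDiffAt ℝ ∞ f r
  int : ∀ z ∈ φ.target, z ∉ closedAnnulus a b → ∃ n : ℤ, f ‖z‖ = n

theorem IsTwistable.neg {φ : OpenPartialHomeomorph S ℂ} {f : ℝ → ℝ} {a b : ℝ}
    (h : IsTwistable φ f a b) : IsTwistable φ (fun r => -f r) a b where
  pos := h.pos
  subset := h.subset
  smooth r hr := (h.smooth r hr).neg
  int z hz hz' := by
    obtain ⟨n, hn⟩ := h.int z hz hz'
    exact ⟨-n, by simp [hn]⟩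

section

variable {φ : OpenPartialHomeomorph S ℂ} {f : ℝ → ℝ} {a b : ℝ}

theorem twistMap_of_mem (x : S) (hx : x ∈ φ.source) :
    twistMap φ f x = φ.symm (radialRotation f (φ x)) := by
  rw [twistMap, if_pos hx]; rfl

theorem twistMap_of_notMem (x : S) (hx : x ∉ φ.source) : twistMap φ f x = x := by
  rw [twistMap, if_neg hx]

theorem IsTwistable.rotation_mem (h : IsTwistable φ f a b) {z : ℂ} (hz : z ∈ φ.target) :
    radialRotation f z ∈ φ.target := by
  by_cases hc : z ∈ closedAnnulus a b
  · exact h.subset (by simpa [closedAnnulus] using hc)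
  · obtain ⟨n, hn⟩ := h.int z hz hc
    rwa [radialRotation_eq_self hn]

theorem IsTwistable.twistMap_eq_self (h : IsTwistable φ f a b) {x : S}
    (hx : x ∉ φ.symm '' closedAnnulus a b) : twistMap φ f x = x := by
  by_cases hs : x ∈ φ.source
  · rw [twistMap_of_mem x hs]
    obtain ⟨n, hn⟩ := h.int (φ x) (φ.map_source hs)
      fun hc => hx ⟨φ x, hc, φ.left_inv hs⟩
    rw [radialRotation_eq_self hn, φ.left_inv hs]
  · exact twistMap_of_notMem x hs

theorem IsTwistable.twistMap_neg_twistMap (h : IsTwistable φ f a b) (x : S) :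
    twistMap φ (fun r => -f r) (twistMap φ f x) = x := by
  by_cases hs : x ∈ φ.source
  · have h1 := h.rotation_mem (φ.map_source hs)
    rw [twistMap_of_mem x hs, twistMap_of_mem _ (φ.map_target h1), φ.right_inv h1,
      radialRotation_neg_radialRotation, φ.left_inv hs]
  · rw [twistMap_of_notMem x hs, twistMap_of_notMem x hs]

theorem IsTwistable.image_subset_source (h : IsTwistable φ f a b) :
    φ.symm '' closedAnnulus a b ⊆ φ.source := by
  rintro _ ⟨z, hz, rfl⟩
  exact φ.map_target (h.subset hz)

theorem IsTwistable.isCompact_image (h : IsTwistable φ f a b) :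
    IsCompact (φ.symm '' closedAnnulus a b) :=
  (isCompact_closedAnnulus a b).image_of_continuousOn (φ.continuousOn_symm.mono h.subset)

/-- The image of the closed annulus is compact, hence closed in a Hausdorff surface. Off it the
twist is locally the identity; on it the chart formula applies, away from the origin where the norm
is not smooth. -/
theorem IsTwistable.twistMap_local [T2Space S] (h : IsTwistable φ f a b) (x : S) :
    (x ∈ φ.source ∧ φ x ≠ 0 ∧ twistMap φ f =ᶠ[𝓝 x] φ.symm ∘ radialRotation f ∘ φ) ∨
      twistMap φ f =ᶠ[𝓝 x] id := by
  by_cases hx : x ∈ φ.symm '' closedAnnulus a b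
  · have hs := h.image_subset_source hx
    refine Or.inl ⟨hs, ?_, ?_⟩
    · obtain ⟨z, hz, rfl⟩ := hx
      rw [φ.right_inv (h.subset hz), ← norm_pos_iff]
      exact h.pos.trans_le hz.1
    · filter_upwards [φ.open_source.mem_nhds hs] with y hy
      exact twistMap_of_mem y hy
  · right
    filter_upwards [h.isCompact_image.isClosed.isOpen_compl.mem_nhds hx] with y hy
    exact h.twistMap_eq_self hy

theorem IsTwistable.contMDiff [T2Space S] [IsManifold 𝓘(ℝ, ℂ) ∞ S] (hφ : IsOrientedChart φ)
    (h : IsTwistable φ f a b) : ContMDiff 𝓘(ℝ, ℂ) 𝓘(ℝ, ℂ) ∞ (twistMap φ f) := by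
  intro x
  obtain ⟨hs, h0, he⟩ | he := h.twistMap_local x
  · refine ContMDiffAt.congr_of_eventuallyEq ?_ he
    have h1 := hφ.smooth.contMDiffAt (φ.open_source.mem_nhds hs)
    have h2 : ContMDiffAt 𝓘(ℝ, ℂ) 𝓘(ℝ, ℂ) ∞ (radialRotation f) (φ x) :=
      (contDiffAt_radialRotation h0 (h.smooth _ (norm_pos_iff.2 h0))).contMDiffAt
    have h3 := hφ.smooth_symm.contMDiffAt
      (φ.open_target.mem_nhds (h.rotation_mem (φ.map_source hs)))
    exact ContMDiffAt.comp x h3 (h2.comp x h1)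
  · exact contMDiffAt_id.congr_of_eventuallyEq he

theorem IsTwistable.jacobian_pos [T2Space S] (hφ : IsOrientedChart φ)
    (h : IsTwistable φ f a b) (x : S) : 0 < surfaceJacobian (twistMap φ f) x := by
  obtain ⟨hs, h0, he⟩ | he := h.twistMap_local x
  · rw [surfaceJacobian_congr he]
    have hm := h.rotation_mem (φ.map_source hs)
    have h1 := (hφ.smooth.contMDiffAt (φ.open_source.mem_nhds hs)).mdifferentiableAt
      (by simp)
    have h20 := contDiffAt_radialRotation h0 (h.smooth _ (norm_pos_iff.2 h0))
    have h2 : MDifferentiableAt 𝓘(ℝ, ℂ) 𝓘(ℝ, ℂ) (radialRotation f) (φ x) :=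
      h20.contMDiffAt.mdifferentiableAt (by simp)
    have h3 := (hφ.smooth_symm.contMDiffAt (φ.open_target.mem_nhds hm)).mdifferentiableAt
      (by simp)
    have h5 := surfaceJacobian_comp (f := φ.symm) (g := radialRotation f ∘ φ) h3 (h2.comp x h1)
    rw [h5, surfaceJacobian_comp h2 h1, Function.comp_apply,
      surfaceJacobian_eq_fderiv, det_fderiv_radialRotation h0
        ((h.smooth _ (norm_pos_iff.2 h0)).differentiableAt (by simp)), one_mul]
    refine mul_pos ?_ (hφ.jacobian_pos x hs)
    have h4 := surfaceJacobian_symm_mul φ hφ.smooth hφ.smooth_symm (φ.map_target hm)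
    rw [φ.right_inv hm] at h4
    exact pos_of_mul_pos_left (h4 ▸ one_pos) (hφ.jacobian_pos _ (φ.map_target hm)).le
  · rw [surfaceJacobian_congr he, OrientedDiffeo.jacobian_id]
    exact one_pos

/-- Twists in annular coordinates are orientation-preserving diffeomorphisms. -/
def IsTwistable.diffeo [T2Space S] [IsManifold 𝓘(ℝ, ℂ) ∞ S] (hφ : IsOrientedChart φ)
    (h : IsTwistable φ f a b) : OrientedDiffeo S where
  toDiffeo :=
    { toFun := twistMap φ f
      invFun := twistMap φ (fun r => -f r)
      left_inv := h.twistMap_neg_twistMap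
      right_inv := fun x => by simpa using h.neg.twistMap_neg_twistMap x
      contMDiff_toFun := h.contMDiff hφ
      contMDiff_invFun := h.neg.contMDiff hφ }
  jacobian_pos := h.jacobian_pos hφ

end

end

/-! ### Paths of twists in the compact-open topology -/

section

variable {S : Type*} [TopologicalSpace S] [ChartedSpace ℂ S]

theorem continuousAt_radialRotation {X : Type*} [TopologicalSpace X] {F : X → ℝ → ℝ} {z : X → ℂ}
    {x : X} (hF : ContinuousAt (fun p : X × ℝ => F p.1 p.2) (x, ‖z x‖)) (hz : ContinuousAt z x) :
    ContinuousAt (fun y => radialRotation (F y) (z y)) x := by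
  unfold radialRotation
  have h1 : ContinuousAt (fun y => F y ‖z y‖) x :=
    ContinuousAt.comp (f := fun y => (y, ‖z y‖)) (g := fun p : X × ℝ => F p.1 p.2) hF
      (continuousAt_id.prodMk hz.norm)
  have h2 : ContinuousAt (fun y => ((2 * Real.pi * F y ‖z y‖ : ℝ) : ℂ)) x :=
    Complex.continuous_ofReal.continuousAt.comp (continuousAt_const.mul h1)
  exact hz.mul ((h2.mul continuousAt_const).cexp)

/-- Twists vary continuously with the annular coordinates and the profile. -/
theorem joined_of_twist_family [T2Space S] [IsManifold 𝓘(ℝ, ℂ) ∞ S]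
    {φ : ℝ → OpenPartialHomeomorph S ℂ} {F : ℝ → ℝ → ℝ} {a b : ℝ}
    (hφ : ∀ s ∈ Icc (0 : ℝ) 1, IsOrientedChart (φ s))
    (hF : ∀ s ∈ Icc (0 : ℝ) 1, IsTwistable (φ s) (F s) a b)
    (hc : ∀ s ∈ Icc (0 : ℝ) 1, ∀ r, 0 < r → ContinuousAt (fun p : ℝ × ℝ => F p.1 p.2) (s, r))
    (hs : ∀ s ∈ Icc (0 : ℝ) 1, ∀ x ∈ (φ s).source,
      ∀ᶠ p : ℝ × S in 𝓝 (s, x), p.2 ∈ (φ p.1).source)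
    (h1 : ∀ s ∈ Icc (0 : ℝ) 1, ∀ x ∈ (φ s).source,
      ContinuousAt (fun p : ℝ × S => φ p.1 p.2) (s, x))
    (h2 : ∀ s ∈ Icc (0 : ℝ) 1, ∀ z ∈ (φ s).target,
      ContinuousAt (fun p : ℝ × ℂ => (φ p.1).symm p.2) (s, z))
    {t₀ t₁ : OrientedDiffeo S} (ht₀ : ∀ x, t₀ x = twistMap (φ 0) (F 0) x)
    (ht₁ : ∀ x, t₁ x = twistMap (φ 1) (F 1) x) : Joined t₀ t₁ := by
  let I := unitInterval
  have hcoe : Continuous (fun p : I × S => ((p.1 : ℝ), p.2)) := by fun_prop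
  let G : I × S → S := fun p => twistMap (φ p.1) (F p.1) p.2
  have hG : Continuous G := by
    rw [continuous_iff_continuousAt]
    rintro ⟨s, x⟩
    by_cases hx : x ∈ (φ s).symm '' closedAnnulus a b
    · have hxs := (hF s s.2).image_subset_source hx
      have hpos : 0 < ‖φ s x‖ := by
        obtain ⟨z, hz, rfl⟩ := hx
        rw [(φ s).right_inv ((hF s s.2).subset hz)]
        exact (hF s s.2).pos.trans_le hz.1
      have he : G =ᶠ[𝓝 (s, x)]
          (fun q : I × S => (φ q.1).symm (radialRotation (F q.1) (φ q.1 q.2))) := by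
        filter_upwards [hcoe.continuousAt.eventually (hs s s.2 x hxs)] with q hq
        exact twistMap_of_mem _ hq
      refine ContinuousAt.congr ?_ he.symm
      have k1 : ContinuousAt (fun q : I × S => φ q.1 q.2) (s, x) :=
        ContinuousAt.comp (g := fun p : ℝ × S => φ p.1 p.2)
          (f := fun p : I × S => ((p.1 : ℝ), p.2)) (h1 s s.2 x hxs) hcoe.continuousAt
      have k2 : ContinuousAt (fun q : I × S => radialRotation (F q.1) (φ q.1 q.2)) (s, x) := by
        refine continuousAt_radialRotation ?_ k1
        refine ContinuousAt.comp (g := fun p : ℝ × ℝ => F p.1 p.2)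
          (f := fun p : (I × S) × ℝ => ((p.1.1 : ℝ), p.2)) (hc s s.2 _ hpos) ?_
        fun_prop
      refine ContinuousAt.comp (g := fun p : ℝ × ℂ => (φ p.1).symm p.2)
        (f := fun q : I × S => ((q.1 : ℝ), radialRotation (F q.1) (φ q.1 q.2))) ?_ ?_
      · exact h2 s s.2 _ ((hF s s.2).rotation_mem ((φ s).map_source hxs))
      · exact ContinuousAt.prodMk (by fun_prop) k2
    -- The annuli of all parameters together sweep out a compact, hence closed, subset of I × S. Off
    -- it the whole family is the identity.
    · let σ : I × ℂ → I × S := fun q => (q.1, (φ q.1).symm q.2)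
      have hZ : IsCompact (σ '' (univ ×ˢ closedAnnulus a b)) := by
        refine (isCompact_univ.prod (isCompact_closedAnnulus a b)).image_of_continuousOn ?_
        rintro ⟨u, z⟩ ⟨-, hz⟩
        refine ContinuousAt.continuousWithinAt (ContinuousAt.prodMk (by fun_prop) ?_)
        exact ContinuousAt.comp (g := fun p : ℝ × ℂ => (φ p.1).symm p.2)
          (f := fun p : I × ℂ => ((p.1 : ℝ), p.2)) (h2 u u.2 z ((hF u u.2).subset hz))
          (by fun_prop)
      have hn : (s, x) ∉ σ '' (univ ×ˢ closedAnnulus a b) := by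
        rintro ⟨⟨u, z⟩, ⟨-, hz⟩, hq⟩
        obtain ⟨rfl, rfl⟩ := Prod.mk.inj hq
        exact hx ⟨z, hz, rfl⟩
      have he : G =ᶠ[𝓝 (s, x)] Prod.snd := by
        filter_upwards [hZ.isClosed.isOpen_compl.mem_nhds hn] with q hq
        refine (hF q.1 q.1.2).twistMap_eq_self fun ⟨z, hz, hzq⟩ => hq ⟨(q.1, z), ⟨trivial, hz⟩, ?_⟩
        exact Prod.ext rfl hzq
      exact continuousAt_snd.congr he.symm
  let γ : I → OrientedDiffeo S := fun s => (hF s s.2).diffeo (hφ s s.2)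
  -- Joint continuity on I × S becomes, by currying, continuity into the compact-open topology.
  have hγ : Continuous γ :=
    continuous_induced_rng.2 (ContinuousMap.curry (⟨G, hG⟩ : C(I × S, S))).continuous
  refine ⟨⟨⟨γ, hγ⟩, ?_, ?_⟩⟩
  · exact OrientedDiffeo.ext' fun x => ((ht₀ x).trans (by rfl)).symm
  · exact OrientedDiffeo.ext' fun x => ((ht₁ x).trans (by rfl)).symm

/-- Twists in the same annular coordinates with profiles that agree outside of an annulus are
isotopic. -/
theorem joined_of_profiles [T2Space S] [IsManifold 𝓘(ℝ, ℂ) ∞ S]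
    {φ : OpenPartialHomeomorph S ℂ} {f g : ℝ → ℝ} {a b : ℝ} (hφ : IsOrientedChart φ)
    (hf : IsTwistable φ f a b) (hg : IsTwistable φ g a b)
    (hfg : ∀ z ∈ φ.target, z ∉ closedAnnulus a b → f ‖z‖ = g ‖z‖)
    {t₀ t₁ : OrientedDiffeo S} (ht₀ : ∀ x, t₀ x = twistMap φ f x)
    (ht₁ : ∀ x, t₁ x = twistMap φ g x) : Joined t₀ t₁ := by
  -- Outside the annulus both profiles equal the same integer, so their affine combinations are
  -- integral there as well.
  refine joined_of_twist_family (φ := fun _ => φ) (F := fun s r => (1 - s) * f r + s * g r)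
    (a := a) (b := b) (fun _ _ => hφ) (fun s _ => ⟨hf.pos, hf.subset, fun r hr => ?_, ?_⟩)
    ?_ ?_ ?_ ?_ (by simpa using ht₀) (by simpa using ht₁)
  · exact (contDiffAt_const.mul (hf.smooth r hr)).add (contDiffAt_const.mul (hg.smooth r hr))
  · intro z hz hz'
    obtain ⟨n, hn⟩ := hf.int z hz hz'
    refine ⟨n, ?_⟩
    rw [← hfg z hz hz', hn]; ring
  · intro s _ r hr
    have k1 : ContinuousAt (fun p : ℝ × ℝ => f p.2) (s, r) :=
      ContinuousAt.comp (g := f) (hf.smooth r hr).continuousAt continuousAt_snd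
    have k2 : ContinuousAt (fun p : ℝ × ℝ => g p.2) (s, r) :=
      ContinuousAt.comp (g := g) (hg.smooth r hr).continuousAt continuousAt_snd
    exact ((continuousAt_const.sub continuousAt_fst).mul k1).add (continuousAt_fst.mul k2)
  · intro s _ x hx
    exact continuousAt_snd.eventually (φ.open_source.mem_nhds hx)
  · intro s _ x hx
    exact ContinuousAt.comp (g := φ) (φ.continuousAt hx) continuousAt_snd
  · intro s _ x hx
    exact ContinuousAt.comp (g := φ.symm) (φ.continuousAt_symm hx) continuousAt_snd

end

/-! ### Inverse function theorem on surfaces -/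

/-- An injective local homeomorphism on an open set is an open partial homeomorphism. -/
theorem exists_openPartialHomeomorph_of_injOn {X Y : Type*} [TopologicalSpace X]
    [TopologicalSpace Y] [Nonempty X] {f : X → Y} {U : Set X} (hU : IsOpen U) (hi : InjOn f U)
    (hloc : ∀ x ∈ U, Filter.map f (𝓝 x) = 𝓝 (f x)) :
    ∃ e : OpenPartialHomeomorph X Y, e.source = U ∧ e.target = f '' U ∧ ⇑e = f := by
  have hc : ContinuousOn f U := fun x hx =>
    ContinuousAt.continuousWithinAt (hloc x hx).le
  have ho : IsOpenMap (U.domRestrict f) := by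
    rw [isOpenMap_iff_nhds_le]
    rintro ⟨x, hx⟩
    have : Filter.map (U.domRestrict f) (𝓝 ⟨x, hx⟩) = Filter.map f (𝓝 x) := by
      rw [← map_nhds_subtype_coe_eq_nhds hx (hU.mem_nhds hx), Filter.map_map]
      rfl
    rw [this, hloc x hx]
    rfl
  exact ⟨OpenPartialHomeomorph.ofContinuousOpenRestrict
    (hi.bijOn_image.toPartialEquiv f U (f '' U)) hc ho hU, rfl, rfl, rfl⟩

section InverseFunction

variable {S : Type*} [TopologicalSpace S] [ChartedSpace ℂ S] [OrientedSurface S]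

/-- The inverse function theorem for maps from a surface to the plane. -/
theorem exists_local_inverse {f : S → ℂ} {x : S}
    (hf : ContMDiffAt 𝓘(ℝ, ℂ) 𝓘(ℝ, ℂ) ∞ f x) (h : 0 < surfaceJacobian f x) :
    ∃ e : OpenPartialHomeomorph S ℂ, x ∈ e.source ∧ EqOn e f e.source ∧
      ContMDiffAt 𝓘(ℝ, ℂ) 𝓘(ℝ, ℂ) ∞ e.symm (f x) := by
  have hx := mem_chart_source ℂ x
  set e₀ := chartAt ℂ x
  have hg := contDiffAt_comp_chartAt_symm hf hx
  rw [surfaceJacobian_eq_mul_chartAt (hf.mdifferentiableAt (by simp)) hx,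
    mul_pos_iff_of_pos_right (surfaceJacobian_chartAt_pos x x hx)] at h
  set g := f ∘ e₀.symm
  let L : ℂ ≃L[ℝ] ℂ := (fderiv ℝ g (e₀ x)).toContinuousLinearEquivOfDetNeZero h.ne'
  have hL : HasFDerivAt g (L : ℂ →L[ℝ] ℂ) (e₀ x) := by
    have := (hg.differentiableAt (by simp)).hasFDerivAt
    simpa [L] using this
  let E := hg.toOpenPartialHomeomorph g hL (by simp)
  have hE : ⇑E = g := hg.toOpenPartialHomeomorph_coe hL (by simp)
  have hxE : e₀ x ∈ E.source := hg.mem_toOpenPartialHomeomorph_source hL (by simp)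
  have hgx : g (e₀ x) = f x := by simp [g, hx]
  refine ⟨e₀.trans E, by simp [hx, hxE], ?_, ?_⟩
  · intro y hy
    have : y ∈ e₀.source := by simp at hy; exact hy.1
    simp [hE, g, this]
  · have h1 : ContMDiffAt 𝓘(ℝ, ℂ) 𝓘(ℝ, ℂ) ∞ E.symm (f x) := by
      have := hg.to_localInverse hL (by simp)
      rw [hgx] at this
      exact this.contMDiffAt
    have h2 : E.symm (f x) = e₀ x := by rw [← hgx, ← hE]; exact E.left_inv hxE
    have h3 : ContMDiffAt 𝓘(ℝ, ℂ) 𝓘(ℝ, ℂ) ∞ e₀.symm (E.symm (f x)) := by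
      rw [h2]
      exact contMDiffOn_chart_symm.contMDiffAt (e₀.open_target.mem_nhds (e₀.map_source hx))
    exact h3.comp _ h1

theorem map_nhds_eq_of_jacobian_pos {f : S → ℂ} {x : S}
    (hf : ContMDiffAt 𝓘(ℝ, ℂ) 𝓘(ℝ, ℂ) ∞ f x) (h : 0 < surfaceJacobian f x) :
    Filter.map f (𝓝 x) = 𝓝 (f x) := by
  obtain ⟨e, hx, he, -⟩ := exists_local_inverse hf h
  have : f =ᶠ[𝓝 x] e := by
    filter_upwards [e.open_source.mem_nhds hx] with y hy using (he hy).symm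
  rw [Filter.map_congr this, e.map_nhds_eq hx, he hx]

theorem exists_injOn_nhds_of_jacobian_pos {f : S → ℂ} {x : S}
    (hf : ContMDiffAt 𝓘(ℝ, ℂ) 𝓘(ℝ, ℂ) ∞ f x) (h : 0 < surfaceJacobian f x) :
    ∃ u ∈ 𝓝 x, InjOn f u := by
  obtain ⟨e, hx, he, -⟩ := exists_local_inverse hf h
  exact ⟨e.source, e.open_source.mem_nhds hx, he.injOn_iff.1 e.injOn⟩

/-- Injectivity gives a global inverse on the image. It is smooth because near each point it
coincides with the local inverse from the inverse function theorem. -/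
theorem exists_isOrientedChart_of_injOn [Nonempty S] {f : S → ℂ} {U : Set S} (hU : IsOpen U)
    (hf : ContMDiffOn 𝓘(ℝ, ℂ) 𝓘(ℝ, ℂ) ∞ f U) (hi : InjOn f U)
    (h : ∀ x ∈ U, 0 < surfaceJacobian f x) :
    ∃ φ : OpenPartialHomeomorph S ℂ, IsOrientedChart φ ∧ φ.source = U ∧ φ.target = f '' U ∧
      ⇑φ = f := by
  have hf' : ∀ x ∈ U, ContMDiffAt 𝓘(ℝ, ℂ) 𝓘(ℝ, ℂ) ∞ f x := fun x hx =>
    hf.contMDiffAt (hU.mem_nhds hx)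
  obtain ⟨φ, hs, ht, hφ⟩ := exists_openPartialHomeomorph_of_injOn hU hi
    fun x hx => map_nhds_eq_of_jacobian_pos (hf' x hx) (h x hx)
  refine ⟨φ, ⟨by rwa [hs, hφ], fun z hz => ContMDiffAt.contMDiffWithinAt ?_,
    fun x hx => by rw [hφ]; exact h x (hs ▸ hx)⟩, hs, ht, hφ⟩
  have hx := φ.map_target hz
  obtain ⟨e, hxe, he, hes⟩ := exists_local_inverse (hf' _ (hs ▸ hx)) (h _ (hs ▸ hx))
  have hfz : f (φ.symm z) = z := by rw [← hφ]; exact φ.right_inv hz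
  rw [hfz] at hes
  have hez : e.symm z = φ.symm z := by
    have : e (φ.symm z) = z := by rw [he hxe, hfz]
    rw [← this, e.left_inv hxe, this]
  have hzt : z ∈ e.target := by
    have := e.map_source hxe
    rwa [he hxe, hfz] at this
  refine hes.congr_of_eventuallyEq ?_
  have h1 : ∀ᶠ w in 𝓝 z, e.symm w ∈ φ.source :=
    (e.continuousAt_symm hzt).eventually (φ.open_source.mem_nhds (by rwa [hez]))
  filter_upwards [h1, e.open_target.mem_nhds hzt] with w hw hwt
  have : φ (e.symm w) = w := by rw [hφ, ← he (e.map_target hwt), e.right_inv hwt]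
  rw [← this, φ.left_inv hw, this]

/-- A map that is injective on a compact set and of positive Jacobian there is a chart near that
set. -/
theorem exists_isOrientedChart_near [T2Space S] [Nonempty S] {f : S → ℂ} {c V : Set S}
    (hc : IsCompact c) (hV : IsOpen V) (hcV : c ⊆ V)
    (hf : ContMDiffOn 𝓘(ℝ, ℂ) 𝓘(ℝ, ℂ) ∞ f V) (hi : InjOn f c)
    (h : ∀ x ∈ c, 0 < surfaceJacobian f x) :
    ∃ φ : OpenPartialHomeomorph S ℂ, IsOrientedChart φ ∧ c ⊆ φ.source ∧ φ.source ⊆ V ∧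
      ⇑φ = f := by
  have hf' : ∀ x ∈ V, ContMDiffAt 𝓘(ℝ, ℂ) 𝓘(ℝ, ℂ) ∞ f x := fun x hx =>
    hf.contMDiffAt (hV.mem_nhds hx)
  obtain ⟨t, ht, hit⟩ := hi.exists_mem_nhdsSet hc (fun x hx => (hf' x (hcV hx)).continuousAt)
    fun x hx => exists_injOn_nhds_of_jacobian_pos (hf' x (hcV hx)) (h x hx)
  have hN : t ∩ V ∩ {x | 0 < surfaceJacobian f x} ∈ 𝓝ˢ c := by
    refine Filter.inter_mem (Filter.inter_mem ht (hV.mem_nhdsSet.2 hcV)) ?_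
    rw [mem_nhdsSet_iff_forall]
    exact fun x hx => eventually_surfaceJacobian_pos (hf' x (hcV hx)) (h x hx)
  obtain ⟨U, hU, hcU, hUN⟩ := mem_nhdsSet_iff_exists.1 hN
  obtain ⟨φ, h1, h2, -, h4⟩ := exists_isOrientedChart_of_injOn hU
    (hf.mono fun x hx => (hUN hx).1.2) (hit.mono fun x hx => (hUN hx).1.1) fun x hx => (hUN hx).2
  exact ⟨φ, h1, h2 ▸ hcU, h2 ▸ fun x hx => (hUN hx).1.2, h4⟩

end InverseFunction

/-! ### Planar determinants and the covering of the core circle -/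

instance : OrientedSurface ℂ where
  det_pos := by
    rintro e he e' he' z -
    rw [chartedSpaceSelf_atlas] at he he'
    subst he he'
    have : ((OpenPartialHomeomorph.refl ℂ).symm.trans (OpenPartialHomeomorph.refl ℂ) : ℂ → ℂ) = id :=
      rfl
    rw [this, fderiv_id, det_complex]
    simp

/-- Both sides are the signed area of the image of the square spanned by v and iv, since the
imaginary part of conj(a) b is the signed area of the parallelogram on a and b. -/
theorem det_mul_normSq (L : ℂ →L[ℝ] ℂ) (v : ℂ) :
    L.det * Complex.normSq v = ((starRingEnd ℂ) (L v) * L (Complex.I * v)).im := by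
  have h (w : ℂ) : L w = w.re * L 1 + w.im * L Complex.I := by
    conv_lhs => rw [← Complex.re_add_im w]
    have h1 : (w.re : ℂ) = w.re • (1 : ℂ) := by simp
    have h2 : (w.im : ℂ) * Complex.I = w.im • Complex.I := by simp
    rw [map_add, h1, h2, map_smul, map_smul]
    simp
  rw [h v, h (Complex.I * v), det_complex, Complex.normSq_apply]
  simp
  ring

/-- With the value at v fixed, the area formula is linear in the value at iv, so the determinant
commutes with affine combinations. This keeps Jacobians positive when local maps are glued. -/
theorem det_sum_smul {ι : Type*} (s : Finset ι) (w : ι → ℝ) (L : ι → ℂ →L[ℝ] ℂ) {v u : ℂ}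
    (hv : v ≠ 0) (hw : ∑ i ∈ s, w i = 1) (hL : ∀ i ∈ s, L i v = u) :
    (∑ i ∈ s, w i • L i).det = ∑ i ∈ s, w i * (L i).det := by
  have hv' : Complex.normSq v ≠ 0 := by simpa using hv
  apply mul_right_cancel₀ hv'
  have h1 : (∑ i ∈ s, w i • L i) v = u := by
    simp only [sum_apply, smul_apply]
    rw [Finset.sum_congr rfl fun i hi => by rw [hL i hi], ← Finset.sum_smul, hw, one_smul]
  rw [det_mul_normSq, h1, Finset.sum_mul]
  simp only [sum_apply, smul_apply, Finset.mul_sum,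
    Complex.im_sum]
  refine Finset.sum_congr rfl fun i hi => ?_
  rw [mul_assoc, det_mul_normSq, hL i hi, mul_smul_comm, Complex.smul_im, smul_eq_mul]

theorem det_fderiv_of_hasDerivAt {f : ℂ → ℂ} {f' z : ℂ} (h : HasDerivAt f f' z) :
    (fderiv ℝ f z).det = ‖f'‖ ^ 2 := by
  rw [(h.hasFDerivAt.restrictScalars ℝ).fderiv, det_complex, Complex.sq_norm, Complex.normSq_apply]
  simp

/-- The covering `t + i u ↦ (3 / 2) e^{2 π i (t + i u)}` of the punctured plane, which wraps the
real line around the core circle. -/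
def coreCover (w : ℂ) : ℂ := 3 / 2 * Complex.exp (2 * Real.pi * Complex.I * w)

theorem hasDerivAt_coreCover (w : ℂ) :
    HasDerivAt coreCover (2 * Real.pi * Complex.I * coreCover w) w := by
  have := (((hasDerivAt_id w).const_mul (2 * Real.pi * Complex.I)).cexp).const_mul (3 / 2 : ℂ)
  refine this.congr_deriv ?_
  rw [coreCover, id_eq]; ring

theorem coreCover_ne_zero (w : ℂ) : coreCover w ≠ 0 := by simp [coreCover]

theorem contDiff_coreCover : ContDiff ℝ ∞ coreCover :=
  contDiff_const.mul ((contDiff_const.mul contDiff_id).cexp)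

theorem norm_coreCover_ofReal (t : ℝ) : ‖coreCover t‖ = 3 / 2 := by
  have : (2 * Real.pi * Complex.I * t : ℂ) = ((2 * Real.pi * t : ℝ) : ℂ) * Complex.I := by
    push_cast; ring
  rw [coreCover, this, norm_mul, Complex.norm_exp_ofReal_mul_I]
  simp

theorem coreCover_add (w v : ℂ) :
    coreCover (w + v) = coreCover w * Complex.exp (2 * Real.pi * Complex.I * v) := by
  rw [coreCover, coreCover, mul_add, Complex.exp_add]
  ring

theorem coreCover_add_int (w : ℂ) (n : ℤ) : coreCover (w + n) = coreCover w := by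
  rw [coreCover_add]
  have : (2 * Real.pi * Complex.I * n : ℂ) = n * (2 * Real.pi * Complex.I) := by ring
  rw [this, Complex.exp_int_mul_two_pi_mul_I, mul_one]

theorem exists_int_of_coreCover_eq {t t' : ℝ} (h : coreCover t = coreCover t') :
    ∃ n : ℤ, t = t' + n := by
  have h1 := mul_left_cancel₀ (by norm_num) h
  obtain ⟨n, hn⟩ := Complex.exp_eq_exp_iff_exists_int.1 h1
  refine ⟨n, ?_⟩
  have h2 : (2 * Real.pi * Complex.I : ℂ) ≠ 0 := Complex.two_pi_I_ne_zero
  have h3 : (t : ℂ) = t' + n := by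
    apply mul_left_cancel₀ h2
    rw [hn]; ring
  exact_mod_cast h3

theorem coreCover_arg {z : ℂ} (hz : ‖z‖ = 3 / 2) :
    coreCover ((z.arg / (2 * Real.pi) : ℝ) : ℂ) = z := by
  have hp : (Real.pi : ℂ) ≠ 0 := by exact_mod_cast Real.pi_ne_zero
  have : (2 * Real.pi * Complex.I * ((z.arg / (2 * Real.pi) : ℝ) : ℂ)) = z.arg * Complex.I := by
    push_cast; field_simp
  have h2 := Complex.norm_mul_exp_arg_mul_I z
  rw [hz] at h2
  rw [coreCover, this]
  refine Eq.trans ?_ h2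
  push_cast
  rfl

theorem exists_coreCover_eq {z : ℂ} (hz : ‖z‖ = 3 / 2) : ∃ t : ℝ, coreCover t = z :=
  ⟨_, coreCover_arg hz⟩

/-- The core circle `|z| = 3 / 2`. -/
def coreCircle : Set ℂ := {z | ‖z‖ = 3 / 2}

theorem isCompact_coreCircle : IsCompact coreCircle := by
  have : coreCircle = Metric.sphere 0 (3 / 2) := by ext; simp [coreCircle]
  rw [this]
  exact isCompact_sphere _ _

/-- A neighbourhood of `[0, 1] × {|z| = 3 / 2}` contains a product with an annulus. -/
theorem exists_prod_annulus_subset {V : Set (ℝ × ℂ)} (hV : IsOpen V)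
    (h : Icc (0 : ℝ) 1 ×ˢ coreCircle ⊆ V) :
    ∃ ε > 0, ∀ s ∈ Icc (0 : ℝ) 1, ∀ w : ℂ, |‖w‖ - 3 / 2| < ε → (s, w) ∈ V := by
  obtain ⟨δ, hδ, hs⟩ := (isCompact_Icc.prod isCompact_coreCircle).exists_thickening_subset_open hV h
  -- The bound 1 < 3/2 keeps w away from 0, so that w can be projected radially to the core circle.
  refine ⟨min δ 1, by positivity, fun s hs' w hw => hs ?_⟩
  have hw0 : ‖w‖ ≠ 0 := by
    intro h0
    rw [h0] at hw
    have := hw.trans_le (min_le_right _ _)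
    norm_num [abs_lt] at this
  rw [Metric.mem_thickening_iff]
  refine ⟨(s, ((3 / 2 / ‖w‖ : ℝ) : ℂ) * w), ⟨hs', ?_⟩, ?_⟩
  · rw [coreCircle, mem_ofPred_eq, norm_mul, Complex.norm_real, Real.norm_of_nonneg (by positivity)]
    field_simp
  · rw [Prod.dist_eq, dist_self, dist_eq_norm]
    have : w - ((3 / 2 / ‖w‖ : ℝ) : ℂ) * w = ((1 - 3 / 2 / ‖w‖ : ℝ) : ℂ) * w := by
      push_cast; ring
    rw [this, norm_mul, Complex.norm_real, Real.norm_eq_abs]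
    have : |1 - 3 / 2 / ‖w‖| * ‖w‖ = |‖w‖ - 3 / 2| := by
      rw [← abs_of_nonneg (norm_nonneg w), ← abs_mul, abs_of_nonneg (norm_nonneg w)]
      congr 1
      field_simp
    rw [this]
    exact max_lt hδ (hw.trans_le (min_le_left _ _))

theorem exists_annulus_subset {V : Set ℂ} (hV : IsOpen V) (h : coreCircle ⊆ V) :
    ∃ ε > 0, ∀ w : ℂ, |‖w‖ - 3 / 2| < ε → w ∈ V := by
  obtain ⟨ε, hε, h1⟩ := exists_prod_annulus_subset (V := univ ×ˢ V) (isOpen_univ.prod hV)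
    (prod_mono (subset_univ _) h)
  exact ⟨ε, hε, fun w hw => (h1 0 (by simp) w hw).2⟩

/-! ### Parametrized curves and charts adapted to them -/

section Curve

variable {S : Type*} [TopologicalSpace S] [ChartedSpace ℂ S]

/-- A regular parametrization of a simple closed curve. -/
structure IsCurveParam (γ : ℝ → S) (c : Set S) : Prop where
  smooth : ContMDiff 𝓘(ℝ, ℝ) 𝓘(ℝ, ℂ) ∞ γ
  periodic : Function.Periodic γ 1
  injOn : InjOn γ (Ico 0 1)
  regular : ∀ t, mfderiv 𝓘(ℝ, ℝ) 𝓘(ℝ, ℂ) γ t ≠ 0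
  range_eq : range γ = c

variable {γ : ℝ → S} {c : Set S}

theorem IsCurveParam.add_int (h : IsCurveParam γ c) (t : ℝ) (n : ℤ) : γ (t + n) = γ t := by
  simpa using (h.periodic.int_mul n) t

theorem IsCurveParam.exists_int (h : IsCurveParam γ c) {t t' : ℝ} (ht : γ t = γ t') :
    ∃ n : ℤ, t = t' + n := by
  have h1 : γ (Int.fract t) = γ (Int.fract t') := by
    have k (t : ℝ) : γ (Int.fract t) = γ t := by
      rw [← h.add_int (Int.fract t) ⌊t⌋, Int.fract_add_floor]
    rw [k, k, ht]
  have h2 := h.injOn ⟨Int.fract_nonneg t, Int.fract_lt_one t⟩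
    ⟨Int.fract_nonneg t', Int.fract_lt_one t'⟩ h1
  refine ⟨⌊t⌋ - ⌊t'⌋, ?_⟩
  rw [Int.fract, Int.fract] at h2
  push_cast
  linarith

theorem IsCurveParam.isCompact (h : IsCurveParam γ c) : IsCompact c := by
  rw [← h.range_eq, ← h.periodic.image_Icc one_pos 0]
  exact isCompact_Icc.image h.smooth.continuous

/-- Parameters of points near `γ t₀` are near `t₀` modulo `1`. -/
theorem IsCurveParam.exists_nhds [T2Space S] (h : IsCurveParam γ c) (t₀ : ℝ) {N : Set ℝ}
    (hN : N ∈ 𝓝 t₀) :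
    ∃ U, IsOpen U ∧ γ t₀ ∈ U ∧ ∀ t, γ t ∈ U → ∃ n : ℤ, t + n ∈ N := by
  obtain ⟨N', hN', hNo, ht⟩ := mem_nhds_iff.1 hN
  -- Every parameter has a representative modulo 1 in this window. Points of the window outside `N'`
  -- do not map to `γ t₀`, since parameters with the same image differ by an integer. So the
  -- complement of the compact image is the required neighbourhood.
  have hK : IsCompact (Icc (t₀ - 1 / 2) (t₀ + 1 / 2) \ N') := isCompact_Icc.diff hNo
  have hK' := (hK.image h.smooth.continuous).isClosed
  refine ⟨_, hK'.isOpen_compl, ?_, fun t htU => ?_⟩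
  · rintro ⟨t, ⟨⟨h1, h2⟩, h3⟩, h4⟩
    obtain ⟨n, hn⟩ := h.exists_int h4
    have h5 : (-1 : ℝ) < n ∧ (n : ℝ) < 1 := by constructor <;> linarith
    have h6 : n = 0 := by
      have a1 : -1 < n := by exact_mod_cast h5.1
      have a2 : n < 1 := by exact_mod_cast h5.2
      omega
    exact h3 (by simpa [hn, h6] using ht)
  · refine ⟨-round (t - t₀), ?_⟩
    by_contra hc
    have h1 := abs_sub_round (t - t₀)
    rw [abs_le] at h1
    refine htU ⟨t + ((-round (t - t₀) : ℤ) : ℝ), ⟨⟨?_, ?_⟩, fun hN => hc (hN' hN)⟩,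
      h.add_int _ _⟩ <;> push_cast <;> linarith

/-- A regular curve is locally a coordinate axis of an oriented chart. -/
theorem IsCurveParam.exists_local_chart [OrientedSurface S] (h : IsCurveParam γ c) (t₀ : ℝ) :
    ∃ (U : Set S) (f : S → ℂ), IsOpen U ∧ γ t₀ ∈ U ∧ ContMDiffOn 𝓘(ℝ, ℂ) 𝓘(ℝ, ℂ) ∞ f U ∧
      (∀ x ∈ U, 0 < surfaceJacobian f x) ∧ ∀ᶠ t in 𝓝 t₀, f (γ t) = coreCover t := by
  set e := chartAt ℂ (γ t₀)
  have hx : γ t₀ ∈ e.source := mem_chart_source ℂ (γ t₀)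
  let α : ℝ → ℂ := e ∘ γ
  have hα : ∀ t, γ t ∈ e.source → ContDiffAt ℝ ∞ α t := fun t ht => by
    have h1 : ContMDiffAt 𝓘(ℝ, ℂ) 𝓘(ℝ, ℂ) ∞ e (γ t) :=
      contMDiffOn_chart.contMDiffAt (e.open_source.mem_nhds ht)
    exact (h1.comp t (h.smooth t)).contDiffAt
  have hd : deriv α t₀ ≠ 0 := by
    intro h0
    apply h.regular t₀
    have h1 := (hα t₀ hx).differentiableAt (by simp)
    have h2 : mfderiv 𝓘(ℝ, ℝ) 𝓘(ℝ, ℂ) α t₀ = 0 := by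
      rw [mfderiv_eq_fderiv]
      rw [← toSpanSingleton_deriv, h0]
      exact ContinuousLinearMap.toSpanSingleton_zero _
    have hde : MDifferentiableAt 𝓘(ℝ, ℂ) 𝓘(ℝ, ℂ) e (γ t₀) :=
      mdifferentiableAt_atlas (chart_mem_atlas ℂ _) hx
    rw [mfderiv_comp t₀ hde (h.smooth.mdifferentiable (by simp) t₀)] at h2
    have hJ := (surfaceJacobian_chartAt_pos (γ t₀) (γ t₀) hx).ne'
    let L : ℂ →L[ℝ] ℂ := mfderiv 𝓘(ℝ, ℂ) 𝓘(ℝ, ℂ) e (γ t₀)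
    refine ContinuousLinearMap.ext fun v => ?_
    have h3 : L (mfderiv 𝓘(ℝ, ℝ) 𝓘(ℝ, ℂ) γ t₀ v) = 0 := DFunLike.congr_fun h2 v
    have h4 : Function.Injective L := (L.toContinuousLinearEquivOfDetNeZero hJ).injective
    exact h4 (h3.trans (map_zero L).symm)
  -- The curve is thickened in the fixed normal direction i α'(t₀); the Jacobian at t₀ is |α'(t₀)|².
  let F : ℂ → ℂ := fun w => α w.re + w.im * (Complex.I * deriv α t₀)
  let V : Set ℂ := {w | γ w.re ∈ e.source}
  have hV : IsOpen V := e.open_source.preimage (h.smooth.continuous.comp Complex.continuous_re)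
  have hF : ContDiffOn ℝ ∞ F V := fun w hw => by
    refine ContDiffAt.contDiffWithinAt ?_
    refine ContDiffAt.add ?_ (ContDiffAt.mul ?_ contDiffAt_const)
    · exact (hα _ hw).comp w Complex.reCLM.contDiff.contDiffAt
    · exact (Complex.ofRealCLM.contDiff.comp Complex.imCLM.contDiff).contDiffAt
  have hF' : 0 < (fderiv ℝ F t₀).det := by
    have h1 := ((hα t₀ hx).differentiableAt (by simp)).hasDerivAt.hasFDerivAt
    have h2 : HasFDerivAt (fun w : ℂ => α w.re) _ (t₀ : ℂ) :=
      HasFDerivAt.comp (g := α) (t₀ : ℂ) (by simpa using h1) Complex.reCLM.hasFDerivAt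
    have h3 : HasFDerivAt (fun w : ℂ => (w.im : ℂ)) _ (t₀ : ℂ) :=
      (Complex.ofRealCLM.hasFDerivAt).comp (t₀ : ℂ) Complex.imCLM.hasFDerivAt
    have h4 := (h2.add (h3.mul_const (Complex.I * deriv α t₀))).fderiv
    have h5 : fderiv ℝ F t₀ = _ := h4
    have h6 : 0 < Complex.normSq (deriv α t₀) := Complex.normSq_pos.2 hd
    rw [h5, det_complex]
    rw [Complex.normSq_apply] at h6
    simpa using h6
  obtain ⟨Φ, hΦ, hcs, hsV, hΦF⟩ := exists_isOrientedChart_near (f := F) (c := {(t₀ : ℂ)})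
    isCompact_singleton hV (by simpa [V] using hx) hF.contMDiffOn (injOn_singleton _ _)
    (by
      rintro _ rfl
      rw [surfaceJacobian_eq_fderiv]
      exact hF')
  rw [singleton_subset_iff] at hcs
  have hFt (t : ℝ) : F t = α t := by simp [F]
  let g : OpenPartialHomeomorph S ℂ := e.trans Φ.symm
  -- Straightening the curve to the real axis and then applying the holomorphic covering wraps it
  -- around the core circle without changing the orientation.
  refine ⟨g.source, coreCover ∘ g, g.open_source, ?_, ?_, ?_, ?_⟩
  · have := Φ.map_source hcs
    rw [hΦF, hFt] at this
    simp only [g, mfld_simps]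
    exact ⟨hx, this⟩
  · intro x hx'
    simp only [g, mfld_simps] at hx'
    refine ContMDiffAt.contMDiffWithinAt ?_
    refine (contDiff_coreCover.contMDiff _).comp x ?_
    exact (hΦ.smooth_symm.contMDiffAt (Φ.open_target.mem_nhds hx'.2)).comp x
      (contMDiffOn_chart.contMDiffAt (e.open_source.mem_nhds hx'.1))
  · intro x hx'
    simp only [g, mfld_simps] at hx'
    have h1 : MDifferentiableAt 𝓘(ℝ, ℂ) 𝓘(ℝ, ℂ) e x :=
      mdifferentiableAt_atlas (chart_mem_atlas ℂ _) hx'.1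
    have h2 := (hΦ.smooth_symm.contMDiffAt (Φ.open_target.mem_nhds hx'.2)).mdifferentiableAt
      (by simp)
    have h3 : MDifferentiableAt 𝓘(ℝ, ℂ) 𝓘(ℝ, ℂ) coreCover (g x) :=
      (contDiff_coreCover.contMDiff _).mdifferentiableAt (by simp)
    have h4 : MDifferentiableAt 𝓘(ℝ, ℂ) 𝓘(ℝ, ℂ) g x := h2.comp x h1
    have h5 : surfaceJacobian g x = surfaceJacobian Φ.symm (e x) * surfaceJacobian e x :=
      surfaceJacobian_comp (f := Φ.symm) (g := e) h2 h1
    rw [surfaceJacobian_comp h3 h4, surfaceJacobian_eq_fderiv,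
      det_fderiv_of_hasDerivAt (hasDerivAt_coreCover _), h5]
    have h6 := surfaceJacobian_symm_mul Φ hΦ.smooth hΦ.smooth_symm (Φ.map_target hx'.2)
    rw [Φ.right_inv hx'.2] at h6
    have h7 := pos_of_mul_pos_left (h6 ▸ one_pos) (hΦ.jacobian_pos _ (Φ.map_target hx'.2)).le
    have h8 := surfaceJacobian_chartAt_pos _ _ hx'.1
    have h9 := coreCover_ne_zero (g x)
    refine mul_pos (pow_pos (norm_pos_iff.2 (mul_ne_zero ?_ h9)) 2) (mul_pos h7 h8)
    exact Complex.two_pi_I_ne_zero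
  · have : ∀ᶠ t : ℝ in 𝓝 t₀, (t : ℂ) ∈ Φ.source :=
      Complex.continuous_ofReal.continuousAt.eventually (Φ.open_source.mem_nhds hcs)
    filter_upwards [this] with t ht
    have h1 : Φ.symm (e (γ t)) = t := by
      have : e (γ t) = Φ t := by rw [hΦF, hFt]; rfl
      rw [this, Φ.left_inv ht]
    simp [g, h1]

end Curve

/-! ### Tubular neighbourhoods of simple closed curves -/

section Tubular

variable {S : Type*} [TopologicalSpace S] [ChartedSpace ℂ S] {γ : ℝ → S} {c : Set S}

/-- Near each point, the circle-valued inverse of the parametrization extends to a smooth map that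
preserves the orientation along the curve. -/
theorem IsCurveParam.exists_local_extension [T2Space S] [OrientedSurface S] (h : IsCurveParam γ c)
    (x : S) :
    ∃ (U : Set S) (f : S → ℂ), IsOpen U ∧ x ∈ U ∧ ContMDiffOn 𝓘(ℝ, ℂ) 𝓘(ℝ, ℂ) ∞ f U ∧
      (∀ t, γ t ∈ U → f (γ t) = coreCover t ∧ 0 < surfaceJacobian f (γ t)) := by
  by_cases hx : x ∈ c
  · rw [← h.range_eq] at hx
    obtain ⟨t₀, rfl⟩ := hx
    obtain ⟨U, f, hU, hxU, hf, hJ, he⟩ := h.exists_local_chart t₀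
    obtain ⟨W, hW, hxW, hWN⟩ := h.exists_nhds t₀ he
    refine ⟨U ∩ W, f, hU.inter hW, ⟨hxU, hxW⟩, hf.mono inter_subset_left, fun t ht =>
      ⟨?_, hJ _ ht.1⟩⟩
    obtain ⟨n, hn⟩ := hWN t ht.2
    have hn' : f (γ (t + n)) = coreCover ((t + n : ℝ) : ℂ) := hn
    rw [h.add_int] at hn'
    rw [hn']
    push_cast
    exact coreCover_add_int _ _
  -- Off the curve nothing is required, so any smooth function will do; the value 0 is arbitrary.
  · refine ⟨cᶜ, fun _ => 0, h.isCompact.isClosed.isOpen_compl, hx, contMDiffOn_const, fun t ht =>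
      absurd ?_ ht⟩
    rw [← h.range_eq]
    exact mem_range_self t

/-- In the product rule the derivative of the weight is multiplied by the value of f, which
vanishes. So the weights of a partition of unity contribute no derivative terms. -/
theorem hasFDerivAt_smul_of_eq_zero {ρ : ℂ → ℝ} {f : ℂ → ℂ} {L : ℂ →L[ℝ] ℂ} {z : ℂ}
    (hρ : DifferentiableAt ℝ ρ z) (hf : HasFDerivAt f L z) (h0 : f z = 0) :
    HasFDerivAt (fun w => ρ w • f w) (ρ z • L) z := by
  have := hρ.hasFDerivAt.smul hf
  rw [h0, ContinuousLinearMap.smulRight_zero, add_zero] at this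
  exact this

/-- The circle-valued inverse of a regular parametrization extends to a smooth map from the surface
to the plane that preserves the orientation along the curve. -/
theorem IsCurveParam.exists_extension [T2Space S] [SecondCountableTopology S] [OrientedSurface S]
    (h : IsCurveParam γ c) :
    ∃ f : S → ℂ, ContMDiff 𝓘(ℝ, ℂ) 𝓘(ℝ, ℂ) ∞ f ∧ (∀ t, f (γ t) = coreCover t) ∧
      ∀ x ∈ c, 0 < surfaceJacobian f x := by
  have := ChartedSpace.locallyCompactSpace ℂ S
  choose U g hU hxU hg hγ using h.exists_local_extension
  obtain ⟨ρ, hρ⟩ := SmoothPartitionOfUnity.exists_isSubordinate 𝓘(ℝ, ℂ) isClosed_univ U hU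
    fun x _ => mem_iUnion.2 ⟨x, hxU x⟩
  have hmem {i : S} {x : S} (hi : x ∈ tsupport (ρ i)) : x ∈ U i := hρ i hi
  set f : S → ℂ := fun y => ∑ᶠ i, ρ i y • g i y
  have hf : ContMDiff 𝓘(ℝ, ℂ) 𝓘(ℝ, ℂ) ∞ f := hρ.contMDiff_finsum_smul hU hg
  have hfγ (t : ℝ) : f (γ t) = coreCover t := by
    refine ρ.finsum_smul_mem_convex (t := {coreCover t}) (mem_univ _) (fun i hi => ?_)
      (convex_singleton _)
    exact (hγ i t (hmem (subset_tsupport _ hi))).1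
  refine ⟨f, hf, hfγ, ?_⟩
  rw [← h.range_eq]
  rintro _ ⟨t, rfl⟩
  set x := γ t
  have hx := mem_chart_source ℂ x
  set e := chartAt ℂ x
  have hex : e.symm (e x) = x := e.left_inv hx
  have hpos := surfaceJacobian_chartAt_pos x x hx
  let J := ρ.fintsupport x
  have hJ {i : S} (hi : i ∈ J) : x ∈ U i := hmem ((ρ.mem_fintsupport_iff x i).1 hi)
  have hsm {i : S} (hi : i ∈ J) : ContMDiffAt 𝓘(ℝ, ℂ) 𝓘(ℝ, ℂ) ∞ (g i) x :=
    (hg i).contMDiffAt ((hU i).mem_nhds (hJ hi))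
  let L : S → ℂ →L[ℝ] ℂ := fun i => fderiv ℝ (g i ∘ e.symm) (e x)
  have hLd {i : S} (hi : i ∈ J) : HasFDerivAt (g i ∘ e.symm) (L i) (e x) :=
    ((contDiffAt_comp_chartAt_symm (hsm hi) hx).differentiableAt (by simp)).hasFDerivAt
  have hdet {i : S} (hi : i ∈ J) : 0 < (L i).det := by
    have h1 := (hγ i t (hJ hi)).2
    rwa [surfaceJacobian_eq_mul_chartAt ((hsm hi).mdifferentiableAt (by simp)) hx,
      mul_pos_iff_of_pos_right hpos] at h1
  have hsum : ∑ i ∈ J, ρ i x = 1 :=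
    ρ.sum_finsupport' x (mem_univ x) (ρ.finsupport_subset_fintsupport x)
  -- the derivatives agree along the curve
  have hα : DifferentiableAt ℝ (e ∘ γ) t := by
    have h1 : ContMDiffAt 𝓘(ℝ, ℂ) 𝓘(ℝ, ℂ) ∞ e x :=
      contMDiffOn_chart.contMDiffAt (e.open_source.mem_nhds hx)
    exact ((h1.comp t (h.smooth t)).contDiffAt).differentiableAt (by simp)
  have hLv {i : S} (hi : i ∈ J) :
      L i (deriv (e ∘ γ) t) = 2 * Real.pi * Complex.I * coreCover t := by
    have h1 := HasFDerivAt.comp_hasDerivAt (l := g i ∘ e.symm) t (hLd hi) hα.hasDerivAt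
    have h2 := (hasDerivAt_coreCover t).comp_ofReal
    have h3 : (fun s : ℝ => coreCover s) =ᶠ[𝓝 t] (g i ∘ e.symm) ∘ (e ∘ γ) := by
      have k1 : ∀ᶠ s in 𝓝 t, γ s ∈ U i :=
        h.smooth.continuous.continuousAt.eventually ((hU i).mem_nhds (hJ hi))
      have k2 : ∀ᶠ s in 𝓝 t, γ s ∈ e.source :=
        h.smooth.continuous.continuousAt.eventually (e.open_source.mem_nhds hx)
      filter_upwards [k1, k2] with s hs1 hs2
      simp [hs2, (hγ i s hs1).1]
    exact h1.unique (h2.congr_of_eventuallyEq h3.symm)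
  obtain ⟨i₀, hi₀⟩ : J.Nonempty := by
    rw [Finset.nonempty_iff_ne_empty]
    intro h0
    rw [h0] at hsum
    simp at hsum
  have hv : deriv (e ∘ γ) t ≠ 0 := by
    intro h0
    have := hLv hi₀
    rw [h0, map_zero] at this
    exact mul_ne_zero Complex.two_pi_I_ne_zero (coreCover_ne_zero t) this.symm
  have hF : HasFDerivAt (f ∘ e.symm) (∑ i ∈ J, ρ i x • L i) (e x) := by
    -- All local maps take the same value at x. Subtracting it makes each factor vanish there, and
    -- it is restored afterwards because the weights sum to 1.
    have h1 : HasFDerivAt (fun w => ∑ i ∈ J, ρ i (e.symm w) • (g i (e.symm w) - coreCover t))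
        (∑ i ∈ J, ρ i x • L i) (e x) := by
      refine HasFDerivAt.fun_sum fun i hi => ?_
      have k1 : DifferentiableAt ℝ (fun w => ρ i (e.symm w)) (e x) := by
        have k2 : ContMDiffAt 𝓘(ℝ, ℂ) 𝓘(ℝ, ℝ) ∞ (fun w => ρ i (e.symm w)) (e x) := by
          refine ContMDiffAt.comp (I' := 𝓘(ℝ, ℂ)) (e x) (ρ i).contMDiff.contMDiffAt ?_
          exact contMDiffOn_chart_symm.contMDiffAt (e.open_target.mem_nhds (e.map_source hx))
        exact (k2.contDiffAt).differentiableAt (by simp)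
      have k3 := hasFDerivAt_smul_of_eq_zero k1 ((hLd hi).sub_const (coreCover t)) (by
        simp only [Function.comp_apply, hex]
        rw [(hγ i t (hJ hi)).1, sub_self])
      rw [hex] at k3
      exact k3
    have h2 := h1.add_const (coreCover t)
    refine h2.congr_of_eventuallyEq ?_
    have h3 : ∀ᶠ w in 𝓝 (e x), ρ.finsupport (e.symm w) ⊆ J := by
      have k1 : Filter.Tendsto e.symm (𝓝 (e x)) (𝓝 x) := by
        have := e.continuousAt_symm (e.map_source hx)
        rwa [ContinuousAt, hex] at this
      exact k1.eventually (ρ.eventually_finsupport_subset x)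
    filter_upwards [h3] with w hw
    have k1 : f (e.symm w) = ∑ i ∈ J, ρ i (e.symm w) • g i (e.symm w) := by
      refine (ρ.sum_finsupport_smul_eq_finsum (e.symm w) g).symm.trans
        (Finset.sum_subset hw fun i _ hi => ?_)
      have : ρ i (e.symm w) = 0 := by
        by_contra hne
        exact hi ((ρ.mem_finsupport _).2 hne)
      rw [this, zero_smul]
    rw [Function.comp_apply, k1]
    simp only [smul_sub, Finset.sum_sub_distrib]
    rw [← Finset.sum_smul, ρ.sum_finsupport' (e.symm w) (mem_univ _) hw, one_smul, sub_add_cancel]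
  rw [surfaceJacobian_eq_mul_chartAt (hf.mdifferentiableAt (by simp)) hx,
    mul_pos_iff_of_pos_right hpos, hF.fderiv, det_sum_smul J (fun i => ρ i x) L hv hsum
      fun i hi => hLv hi]
  obtain ⟨i, hi⟩ := ρ.exists_pos_of_mem (mem_univ x)
  have hiJ : i ∈ J := (ρ.mem_fintsupport_iff x i).2 (subset_tsupport _ hi.ne')
  exact Finset.sum_pos' (fun j hj => mul_nonneg (ρ.nonneg j x) (hdet hj).le)
    ⟨i, hiJ, mul_pos hi (hdet hiJ)⟩

/-- The radial map that takes the annulus of width `2 ε` around the core circle to the one of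
width `1`. -/
def radialRescale (ε : ℝ) (z : ℂ) : ℂ :=
  z * (((3 / 2 + (‖z‖ - 3 / 2) / (2 * ε)) / ‖z‖ : ℝ) : ℂ)

theorem norm_radialRescale {ε : ℝ} (hε : 0 < ε) {z : ℂ} (hz : z ≠ 0) (h : |‖z‖ - 3 / 2| < ε) :
    ‖radialRescale ε z‖ = 3 / 2 + (‖z‖ - 3 / 2) / (2 * ε) := by
  have h1 : -(1 / 2) < (‖z‖ - 3 / 2) / (2 * ε) := by
    rw [lt_div_iff₀ (by positivity)]
    linarith [(abs_lt.1 h).1]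
  have hz' : 0 < ‖z‖ := norm_pos_iff.2 hz
  rw [radialRescale, norm_mul, Complex.norm_real, Real.norm_of_nonneg]
  · field_simp
  · exact div_nonneg (by linarith) hz'.le

theorem contDiffAt_radialRescale (ε : ℝ) {z : ℂ} (hz : z ≠ 0) :
    ContDiffAt ℝ ∞ (radialRescale ε) z := by
  have h1 := contDiffAt_norm ℝ hz (n := ∞)
  refine contDiffAt_id.mul (Complex.ofRealCLM.contDiff.contDiffAt.comp z ?_)
  exact (contDiffAt_const.add ((h1.sub contDiffAt_const).div_const _)).div h1 (by simpa using hz)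

/-- The radius r goes to q(r) with q' = 1 / (2ε) and the angle is kept, so the determinant is q q' /
r. The bound on the radius gives q > 1. -/
theorem det_fderiv_radialRescale_pos {ε : ℝ} (hε : 0 < ε) {z : ℂ} (hz : z ≠ 0)
    (h : |‖z‖ - 3 / 2| < ε) : 0 < (fderiv ℝ (radialRescale ε) z).det := by
  have hz' : 0 < ‖z‖ := norm_pos_iff.2 hz
  have h1 : -(1 / 2) < (‖z‖ - 3 / 2) / (2 * ε) := by
    rw [lt_div_iff₀ (by positivity)]
    linarith [(abs_lt.1 h).1]
  have hd := (((((hasDerivAt_id ‖z‖).sub_const (3 / 2)).div_const (2 * ε)).const_add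
    (3 / 2)).div (hasDerivAt_id ‖z‖) hz'.ne').ofReal_comp
  refine lt_of_lt_of_eq ?_ (hasFDerivAt_mul_radial hz hd).2.symm
  set q := 3 / 2 + (‖z‖ - 3 / 2) / (2 * ε) with hq
  have hq0 : 0 < q := by linarith
  simp only [Pi.div_apply, id]
  rw [← hq, Complex.conj_ofReal, ← Complex.ofReal_mul, Complex.ofReal_re, Complex.norm_real,
    Real.norm_eq_abs, sq_abs]
  have : (q / ‖z‖) ^ 2 + ‖z‖ * (q / ‖z‖ * ((1 / (2 * ε) * ‖z‖ - q * 1) / ‖z‖ ^ 2)) =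
    q / (2 * ε * ‖z‖) := by field_simp; ring
  rw [this]
  positivity

/-- Every simple closed curve has oriented annular coordinates. -/
theorem SimpleClosedCurve.exists_isBicollar [T2Space S] [SecondCountableTopology S]
    [OrientedSurface S] (c : SimpleClosedCurve S) :
    ∃ φ : OpenPartialHomeomorph S ℂ, IsBicollar φ c := by
  obtain ⟨γ, h1, h2, h3, h4, h5⟩ := c.exists_param
  have h : IsCurveParam γ c.carrier := ⟨h1, h2, h3, h4, h5⟩
  have : Nonempty S := ⟨γ 0⟩
  obtain ⟨f, hf, hfγ, hJ⟩ := h.exists_extension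
  have himg : f '' c.carrier = coreCircle := by
    rw [← h.range_eq, ← range_comp]
    ext z
    constructor
    · rintro ⟨t, rfl⟩
      simp only [Function.comp_apply, hfγ]
      exact norm_coreCover_ofReal t
    · intro hz
      obtain ⟨t, ht⟩ := exists_coreCover_eq hz
      exact ⟨t, by simp [hfγ, ht]⟩
  have hinj : InjOn f c.carrier := by
    rw [← h.range_eq]
    rintro _ ⟨t, rfl⟩ _ ⟨t', rfl⟩ htt
    rw [hfγ, hfγ] at htt
    obtain ⟨n, rfl⟩ := exists_int_of_coreCover_eq htt
    exact h.add_int _ _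
  obtain ⟨φ, hφ, hcs, -, hφf⟩ := exists_isOrientedChart_near h.isCompact isOpen_univ
    (subset_univ _) hf.contMDiffOn hinj hJ
  have hK : coreCircle ⊆ φ.target := by
    rw [← himg, ← hφf]
    rintro _ ⟨x, hx, rfl⟩
    exact φ.map_source (hcs hx)
  obtain ⟨ε, hε, hA⟩ := exists_annulus_subset φ.open_target hK
  -- The bound δ ≤ 1 keeps the origin, where rescaling is singular, out of the annulus.
  obtain ⟨δ, hδ, hδ1, hδε⟩ : ∃ δ > 0, δ ≤ 1 ∧ δ ≤ ε :=
    ⟨min 1 ε, by positivity, min_le_left _ _, min_le_right _ _⟩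
  let A : Set ℂ := {z | |‖z‖ - 3 / 2| < δ}
  have hAo : IsOpen A := isOpen_lt (by fun_prop) continuous_const
  have hA0 {z : ℂ} (hz : z ∈ A) : z ≠ 0 := by
    rintro rfl
    have : |‖(0 : ℂ)‖ - 3 / 2| < δ := hz
    rw [norm_zero, abs_lt] at this
    linarith
  have hAt : A ⊆ φ.target := fun z hz => hA z (lt_of_lt_of_le hz hδε)
  let U : Set S := φ.source ∩ φ ⁻¹' A
  have hU : IsOpen U := φ.isOpen_inter_preimage hAo
  let g : S → ℂ := radialRescale δ ∘ φ
  have hg : ContMDiffOn 𝓘(ℝ, ℂ) 𝓘(ℝ, ℂ) ∞ g U := fun x hx =>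
    ((contDiffAt_radialRescale δ (hA0 hx.2)).contMDiffAt.comp x
      (hφ.smooth.contMDiffAt (φ.open_source.mem_nhds hx.1))).contMDiffWithinAt
  have hgn {x : S} (hx : x ∈ U) : ‖g x‖ = 3 / 2 + (‖φ x‖ - 3 / 2) / (2 * δ) :=
    norm_radialRescale hδ (hA0 hx.2) hx.2
  have hgi : InjOn g U := by
    intro x hx y hy hxy
    have k1 : ‖φ x‖ = ‖φ y‖ := by
      have := hgn hx
      rw [hxy, hgn hy] at this
      field_simp at this
      linarith
    have hq : 0 < ‖g x‖ := by
      rw [hgn hx]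
      have : |‖φ x‖ - 3 / 2| < δ := hx.2
      have h1 : -(1 / 2) < (‖φ x‖ - 3 / 2) / (2 * δ) := by
        rw [lt_div_iff₀ (by positivity)]
        linarith [(abs_lt.1 this).1]
      linarith
    have k2 : g x = φ x * (((3 / 2 + (‖φ x‖ - 3 / 2) / (2 * δ)) / ‖φ x‖ : ℝ) : ℂ) := rfl
    have k3 : g y = φ y * (((3 / 2 + (‖φ x‖ - 3 / 2) / (2 * δ)) / ‖φ x‖ : ℝ) : ℂ) := by
      rw [k1]; rfl
    refine φ.injOn hx.1 hy.1 (mul_right_cancel₀ ?_ ((k2.symm.trans hxy).trans k3))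
    intro h0
    rw [k2, h0, mul_zero, norm_zero] at hq
    exact hq.false
  have hgJ : ∀ x ∈ U, 0 < surfaceJacobian g x := fun x hx => by
    have k1 : MDifferentiableAt 𝓘(ℝ, ℂ) 𝓘(ℝ, ℂ) (radialRescale δ) (φ x) :=
      (contDiffAt_radialRescale δ (hA0 hx.2)).contMDiffAt.mdifferentiableAt (by simp)
    have k2 := (hφ.smooth.contMDiffAt (φ.open_source.mem_nhds hx.1)).mdifferentiableAt (by simp)
    rw [surfaceJacobian_comp k1 k2, surfaceJacobian_eq_fderiv]
    exact mul_pos (det_fderiv_radialRescale_pos hδ (hA0 hx.2) hx.2) (hφ.jacobian_pos x hx.1)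
  obtain ⟨ψ, hψ, hψs, hψt, hψg⟩ := exists_isOrientedChart_of_injOn hU hg hgi hgJ
  have hcA {x : S} (hx : x ∈ c.carrier) : ‖φ x‖ = 3 / 2 := by
    have : f x ∈ coreCircle := himg ▸ mem_image_of_mem f hx
    rw [hφf]
    exact this
  have hgc {x : S} (hx : x ∈ c.carrier) : g x = φ x := by
    simp [g, radialRescale, hcA hx]
  refine ⟨ψ, ?_, hψ.smooth, hψ.smooth_symm, hψ.jacobian_pos, ?_, ?_⟩
  · rw [hψt]
    ext w
    constructor
    · rintro ⟨x, hx, rfl⟩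
      have k : |‖φ x‖ - 3 / 2| < δ := hx.2
      rw [abs_lt] at k
      have k1 : -(1 / 2) < (‖φ x‖ - 3 / 2) / (2 * δ) := by
        rw [lt_div_iff₀ (by positivity)]; linarith
      have k2 : (‖φ x‖ - 3 / 2) / (2 * δ) < 1 / 2 := by
        rw [div_lt_iff₀ (by positivity)]; linarith
      simp only [mem_ofPred_eq, hgn hx]
      constructor <;> linarith
    · rintro ⟨hw1, hw2⟩
      -- This inverts the rescaling of radii; the preimage of w lies on the same ray at radius r.
      set r := 3 / 2 + 2 * δ * (‖w‖ - 3 / 2) with hr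
      have hrδ : |r - 3 / 2| < δ := by
        rw [abs_lt]
        constructor <;> nlinarith
      have hr0 : 0 < r := by linarith [(abs_lt.1 hrδ).1]
      have hw0 : ‖w‖ ≠ 0 := by positivity
      let z : ℂ := ((r / ‖w‖ : ℝ) : ℂ) * w
      have hz : ‖z‖ = r := by
        simp only [z]
        rw [norm_mul, Complex.norm_real, Real.norm_of_nonneg (by positivity)]
        field_simp
      have hzA : z ∈ A := by simp only [A, mem_ofPred_eq, hz]; exact hrδ
      refine ⟨φ.symm z, ⟨φ.map_target (hAt hzA), ?_⟩, ?_⟩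
      · rw [mem_preimage, φ.right_inv (hAt hzA)]; exact hzA
      · simp only [g, Function.comp_apply, φ.right_inv (hAt hzA), radialRescale, hz]
        simp only [z]
        rw [mul_right_comm, ← Complex.ofReal_mul]
        have : r / ‖w‖ * ((3 / 2 + (r - 3 / 2) / (2 * δ)) / r) = 1 := by
          have k : (r - 3 / 2) / (2 * δ) = ‖w‖ - 3 / 2 := by rw [hr]; field_simp; ring
          rw [k, add_sub_cancel]
          field_simp
        rw [this, Complex.ofReal_one, one_mul]
  · rw [hψs]
    intro x hx
    refine ⟨hcs hx, ?_⟩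
    simp only [mem_preimage, A, mem_ofPred_eq, hcA hx]
    simpa using hδ
  · rw [hψg]
    refine (image_congr fun x hx => hgc hx).trans ?_
    rw [hφf]
    exact himg

end Tubular

/-! ### Maps preserving the core circle and their isotopy to the identity -/

theorem norm_coreCover (w : ℂ) : ‖coreCover w‖ = 3 / 2 * Real.exp (-(2 * Real.pi * w.im)) := by
  rw [coreCover, norm_mul, Complex.norm_exp]
  congr 1
  · simp
  · congr 1
    simp

/-- A regular curve in the core circle lifts to the line, with derivative of constant sign. -/
theorem exists_coreCover_lift {η η' : ℝ → ℂ} (hη : ∀ t, HasDerivAt η (η' t) t)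
    (hc : Continuous η') (hn : ∀ t, ‖η t‖ = 3 / 2) (h0 : ∀ t, η' t ≠ 0) :
    ∃ θ q : ℝ → ℝ, (∀ t, HasDerivAt θ (q t) t) ∧ (∀ t, η t = coreCover (θ t)) ∧
      ((∀ t, 0 < q t) ∨ ∀ t, q t < 0) := by
  have hηc : Continuous η := continuous_iff_continuousAt.2 fun t => (hη t).continuousAt
  have hη0 (t : ℝ) : η t ≠ 0 := by
    intro h
    have := hn t
    rw [h, norm_zero] at this
    norm_num at this
  obtain ⟨t₀, ht₀⟩ := exists_coreCover_eq (hn 0)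
  -- The lift is the integral of the logarithmic derivative divided by 2πi. It is real because the
  -- modulus of η is constant.
  let Q : ℝ → ℂ := fun t => η' t / (2 * Real.pi * Complex.I * η t)
  have hQ : Continuous Q :=
    hc.div (continuous_const.mul hηc) fun t => mul_ne_zero Complex.two_pi_I_ne_zero (hη0 t)
  let Θ : ℝ → ℂ := fun t => t₀ + ∫ u in (0 : ℝ)..t, Q u
  have hΘ (t : ℝ) : HasDerivAt Θ (Q t) t :=
    ((hQ.integral_hasStrictDerivAt 0 t).hasDerivAt).const_add _
  have hΘ0 : Θ 0 = t₀ := by simp [Θ]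
  have hlift (t : ℝ) : η t = coreCover (Θ t) := by
    have h1 (t : ℝ) : HasDerivAt (fun u => η u / coreCover (Θ u)) 0 t := by
      have k := (hη t).div ((hasDerivAt_coreCover (Θ t)).comp t (hΘ t)) (coreCover_ne_zero _)
      refine k.congr_deriv ?_
      have e1 := coreCover_ne_zero (Θ t)
      have e2 := hη0 t
      have e3 : (2 * Real.pi * Complex.I : ℂ) ≠ 0 := Complex.two_pi_I_ne_zero
      simp only [Q, Function.comp_apply]
      rw [div_eq_zero_iff]
      left
      have : 2 * Real.pi * Complex.I * coreCover (Θ t) * (η' t / (2 * Real.pi * Complex.I * η t)) =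
        coreCover (Θ t) * η' t / η t := by
        rw [← mul_div_assoc, mul_assoc _ (coreCover (Θ t)), mul_div_mul_left _ _ e3]
      rw [this]
      field_simp
      ring
    have h2 := is_const_of_deriv_eq_zero (fun t => (h1 t).differentiableAt)
      (fun t => (h1 t).deriv) t 0
    simp only [hΘ0, ht₀, div_self (hη0 0)] at h2
    exact (div_eq_one_iff_eq (coreCover_ne_zero _)).1 h2
  have him (t : ℝ) : (Θ t).im = 0 := by
    have h1 := hn t
    rw [hlift, norm_coreCover] at h1
    have h2 : Real.exp (-(2 * Real.pi * (Θ t).im)) = 1 := by linarith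
    rw [Real.exp_eq_one_iff] at h2
    have := Real.pi_pos
    simpa [this.ne'] using h2
  have hre (t : ℝ) : Θ t = ((Θ t).re : ℂ) := Complex.ext (by simp) (by simp [him])
  have hd (t : ℝ) : HasDerivAt (fun u => (Θ u).re) (Q t).re t :=
    (Complex.reCLM.hasFDerivAt (x := Θ t)).comp_hasDerivAt t (hΘ t)
  have hQre (t : ℝ) : Q t = ((Q t).re : ℂ) := by
    have h1 := (hd t).ofReal_comp
    have h2 : (fun u => (((Θ u).re : ℝ) : ℂ)) = Θ := funext fun u => (hre u).symm
    rw [h2] at h1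
    exact (hΘ t).unique h1
  have hq0 (t : ℝ) : (Q t).re ≠ 0 := by
    intro h
    have h1 := hQre t
    rw [h, Complex.ofReal_zero] at h1
    have := (div_eq_zero_iff.1 h1).resolve_right
      (mul_ne_zero Complex.two_pi_I_ne_zero (hη0 t))
    exact h0 t this
  have hqc : Continuous fun t => (Q t).re := Complex.continuous_re.comp hQ
  refine ⟨fun t => (Θ t).re, fun t => (Q t).re, hd, fun t => by rw [hlift, ← hre], ?_⟩
  by_contra! hcon
  obtain ⟨⟨t, ht⟩, t', ht'⟩ := hcon
  obtain ⟨u, hu⟩ := mem_range_of_exists_le_of_exists_ge hqc ⟨t, ht⟩ ⟨t', ht'⟩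
  exact hq0 u hu

/-- A strictly increasing lift of an injective self-map of the circle has degree one. -/
theorem lift_add_one {θ : ℝ → ℝ} (hm : StrictMono θ) (hc : Continuous θ)
    (hp : ∀ t, coreCover (θ (t + 1)) = coreCover (θ t))
    (hi : ∀ t t' : ℝ, coreCover (θ t) = coreCover (θ t') → ∃ n : ℤ, t = t' + n) (t : ℝ) :
    θ (t + 1) = θ t + 1 := by
  obtain ⟨n, hn⟩ := exists_int_of_coreCover_eq (hp t)
  have h1 : θ t < θ (t + 1) := hm (by linarith)
  have h2 : 0 < n := by
    have : (0 : ℝ) < n := by linarith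
    exact_mod_cast this
  obtain h3 | h3 : n = 1 ∨ 2 ≤ n := by omega
  · rw [hn, h3]; simp
  · exfalso
    have h4 : (2 : ℝ) ≤ n := by exact_mod_cast h3
    -- If θ advanced by at least 2, it would pass θ t + 1 strictly inside the period, giving two
    -- distinct parameters modulo 1 with the same image.
    obtain ⟨u, hu, hu'⟩ := intermediate_value_Ioo (by linarith : t ≤ t + 1) hc.continuousOn
      (show θ t + 1 ∈ Ioo (θ t) (θ (t + 1)) from ⟨by linarith, by linarith⟩)
    obtain ⟨m, hm'⟩ := hi u t (by
      rw [hu']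
      have := coreCover_add_int (θ t) 1
      push_cast at this ⊢
      exact this)
    have h5 : (0 : ℝ) < m := by linarith [hu.1]
    have h6 : (m : ℝ) < 1 := by linarith [hu.2]
    have h7 : 0 < m := by exact_mod_cast h5
    have h8 : m < 1 := by exact_mod_cast h6
    omega

/-- Logarithm of the quotient of a self-map of degree one near the core circle by the identity. -/
theorem exists_log_quotient {ψ : ℂ → ℂ} {V : Set ℂ} {θ : ℝ → ℝ} (hV : IsOpen V)
    (hKV : coreCircle ⊆ V) (hψ : ContDiffOn ℝ ∞ ψ V) (hc : Continuous θ)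
    (hθ : ∀ t, θ (t + 1) = θ t + 1) (hlift : ∀ t : ℝ, ψ (coreCover t) = coreCover (θ t)) :
    ∃ (W : Set ℂ) (g : ℂ → ℂ), IsOpen W ∧ coreCircle ⊆ W ∧ W ⊆ V ∧ ContDiffOn ℝ ∞ g W ∧
      (∀ z ∈ W, z * Complex.exp (g z) = ψ z) ∧
      ∀ t : ℝ, g (coreCover t) = 2 * Real.pi * Complex.I * (θ t - t : ℝ) := by
  let p : ℝ → ℝ := fun x => θ (x / (2 * Real.pi)) - x / (2 * Real.pi)
  have hpi := Real.pi_pos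
  have hp : Function.Periodic p (2 * Real.pi) := fun x => by
    have : (x + 2 * Real.pi) / (2 * Real.pi) = x / (2 * Real.pi) + 1 := by field_simp
    simp only [p, this, hθ]
    ring
  have hpc : Continuous p := by fun_prop
  let P : Real.Angle → ℝ := hp.lift
  have hPc : Continuous P := continuous_coinduced_dom.2 hpc
  -- The displacement θ t - t is periodic, so it defines a continuous function of the angle: a
  -- branch of log(ψ(z)/z) on the core circle, extended constantly along rays. The quotient `Q` is
  -- then 1 on the circle and has a principal logarithm nearby.
  let a : ℂ → ℂ := fun z => 2 * Real.pi * Complex.I * (P (z.arg : Real.Angle) : ℂ)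
  have ha {z : ℂ} (hz : z ≠ 0) : ContinuousAt a z :=
    continuousAt_const.mul (Complex.continuous_ofReal.continuousAt.comp
      (hPc.continuousAt.comp (Complex.continuousAt_arg_coe_angle hz)))
  have haκ (t : ℝ) : a (coreCover t) = 2 * Real.pi * Complex.I * (θ t - t : ℝ) := by
    have h1 : P ((coreCover t).arg : Real.Angle) = p (2 * Real.pi * t) := by
      obtain ⟨n, hn⟩ := exists_int_of_coreCover_eq
        (coreCover_arg (norm_coreCover_ofReal t)).symm
      have k (A : ℝ) (h : t = A / (2 * Real.pi) + n) :
          2 * Real.pi * t = A + n * (2 * Real.pi) := by rw [h]; field_simp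
      have h2 := k _ hn
      rw [h2, hp.int_mul n]
      rfl
    simp only [a, h1, p]
    congr 4 <;> field_simp
  let Q : ℂ → ℂ := fun z => ψ z / (z * Complex.exp (a z))
  have hV0 : IsOpen (V ∩ {0}ᶜ) := hV.inter isOpen_compl_singleton
  have hQc : ContinuousOn Q (V ∩ {0}ᶜ) := fun z hz => by
    refine ContinuousAt.continuousWithinAt ?_
    have h1 := (hψ.contDiffAt (hV.mem_nhds hz.1)).continuousAt
    exact h1.div (continuousAt_id.mul (ha hz.2).cexp)
      (mul_ne_zero hz.2 (Complex.exp_ne_zero _))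
  let W : Set ℂ := (V ∩ {0}ᶜ) ∩ Q ⁻¹' Complex.slitPlane
  have hW : IsOpen W := hQc.isOpen_inter_preimage hV0 Complex.isOpen_slitPlane
  let g : ℂ → ℂ := fun z => a z + Complex.log (Q z)
  have hgexp : ∀ z ∈ W, z * Complex.exp (g z) = ψ z := fun z hz => by
    have h1 : Q z ≠ 0 := Complex.slitPlane_ne_zero hz.2
    have h2 : z ≠ 0 := hz.1.2
    have h3 := Complex.exp_ne_zero (a z)
    simp only [g, Complex.exp_add, Complex.exp_log h1]
    simp only [Q]
    field_simp
  have hgc {z : ℂ} (hz : z ∈ W) : ContinuousAt g z := by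
    have h1 : ContinuousAt Q z := hQc.continuousAt (hV0.mem_nhds hz.1)
    exact (ha hz.1.2).add (h1.clog hz.2)
  have hQκ (t : ℝ) : Q (coreCover t) = 1 := by
    have h1 := coreCover_add t (θ t - t : ℝ)
    rw [← haκ] at h1
    simp only [Q, hlift]
    rw [← h1, Complex.ofReal_sub, add_sub_cancel, div_self (coreCover_ne_zero _)]
  refine ⟨W, g, hW, fun z hz => ?_, fun z hz => hz.1.1, fun z₀ hz₀ => ?_, hgexp, fun t => ?_⟩
  · obtain ⟨t, rfl⟩ := exists_coreCover_eq hz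
    exact ⟨⟨hKV hz, coreCover_ne_zero _⟩, by simp [hQκ]⟩
  · have hz0 : z₀ ≠ 0 := hz₀.1.2
    have hψ0 : ψ z₀ ≠ 0 := by
      rw [← hgexp z₀ hz₀]; exact mul_ne_zero hz0 (Complex.exp_ne_zero _)
    -- The function `a` is only known to be continuous. Smoothness of g comes from the smooth
    -- quotient ψ(z)/z: normalized to 1 at z₀, it has principal logarithm g(z) - g(z₀) near z₀, by
    -- continuity of g.
    let h : ℂ → ℂ := fun z => ψ z * z⁻¹ * (ψ z₀ / z₀)⁻¹
    have h1 : ContDiffAt ℝ ∞ h z₀ :=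
      ((hψ.contDiffAt (hV.mem_nhds hz₀.1.1)).mul (contDiffAt_id.inv hz0)).mul contDiffAt_const
    have h2 : h z₀ = 1 := by
      simp only [h, ← div_eq_mul_inv]
      exact div_self (div_ne_zero hψ0 hz0)
    have h3 : ContDiffAt ℝ ∞ (fun z => g z₀ + Complex.log (h z)) z₀ := by
      have k : ContDiffAt ℝ ∞ Complex.log (h z₀) :=
        (Complex.contDiffAt_log (by simp [h2])).restrict_scalars ℝ
      exact contDiffAt_const.add (k.comp z₀ h1)
    refine (h3.congr_of_eventuallyEq ?_).contDiffWithinAt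
    have h4 : ContinuousAt (fun z => (g z - g z₀).im) z₀ :=
      Complex.continuous_im.continuousAt.comp ((hgc hz₀).sub continuousAt_const)
    have h5 : ∀ᶠ z in 𝓝 z₀, (g z - g z₀).im ∈ Ioo (-Real.pi) Real.pi :=
      h4.eventually (isOpen_Ioo.mem_nhds (by simp [hpi]))
    filter_upwards [h5, hW.mem_nhds hz₀] with z hz hzW
    have h6 : Complex.exp (g z - g z₀) = h z := by
      have e1 := hgexp z hzW
      have e2 := hgexp z₀ hz₀
      have e3 : z ≠ 0 := hzW.1.2
      simp only [h, ← div_eq_mul_inv, ← e1, ← e2, Complex.exp_sub]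
      rw [mul_div_cancel_left₀ _ e3, mul_div_cancel_left₀ _ hz0]
    rw [← h6, Complex.log_exp hz.1 hz.2.le]
    ring
  · simp only [g, hQκ, haκ, Complex.log_one, add_zero]

/-- The vectors iz and z are tangential and radial. Up to the common factor exp(s g(z)), the
tangential vector is only stretched, by 1 + s(q - 1), so the determinant sees only the radial part 1
+ s Re G(z) of the image of z. Both stretches are affine in s. -/
theorem det_fderiv_mul_exp {g : ℂ → ℂ} {G : ℂ →L[ℝ] ℂ} {z : ℂ} {q : ℝ} (s : ℝ) (hz : z ≠ 0)
    (hg : HasFDerivAt g G z) (hG : G (Complex.I * z) = Complex.I * (q - 1 : ℝ)) :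
    (fderiv ℝ (fun w => w * Complex.exp (s * g w)) z).det =
      Complex.normSq (Complex.exp (s * g z)) * ((1 + s * (q - 1)) * (1 + s * (G z).re)) := by
  have h1 := (hasFDerivAt_id (𝕜 := ℝ) z).mul ((hg.const_mul (s : ℂ)).cexp)
  have h2 : fderiv ℝ (fun w => w * Complex.exp (s * g w)) z = _ := h1.fderiv
  have hz' : Complex.normSq (Complex.I * z) ≠ 0 := by simpa using hz
  apply mul_right_cancel₀ hz'
  rw [det_mul_normSq]
  set E := Complex.exp (s * g z) with hE
  have h3 : fderiv ℝ (fun w => w * Complex.exp (s * g w)) z (Complex.I * z) =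
      E * z * (Complex.I * (1 + s * (q - 1) : ℝ)) := by
    rw [h2]
    simp [hG]
    ring
  have h4 : fderiv ℝ (fun w => w * Complex.exp (s * g w)) z (Complex.I * (Complex.I * z)) =
      - (E * z * (1 + s * G z)) := by
    rw [h2]
    have : Complex.I * (Complex.I * z) = -z := by rw [← mul_assoc, Complex.I_mul_I]; ring
    rw [this]
    simp
    ring
  rw [h3, h4]
  simp only [map_mul, Complex.normSq_I, one_mul]
  have h5 : (starRingEnd ℂ) E * (starRingEnd ℂ) z * ((starRingEnd ℂ) Complex.I *
      (starRingEnd ℂ) (1 + s * (q - 1) : ℝ)) * -(E * z * (1 + s * G z)) =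
      ((E * (starRingEnd ℂ) E) * (z * (starRingEnd ℂ) z) * (1 + s * (q - 1) : ℝ)) *
        (Complex.I * (1 + s * G z)) := by
    rw [Complex.conj_I, Complex.conj_ofReal]; ring
  rw [h5, Complex.mul_conj, Complex.mul_conj, ← Complex.ofReal_mul, ← Complex.ofReal_mul,
    Complex.im_ofReal_mul]
  simp
  ring

/-- The graph of a family of maps of the plane is locally invertible where its slices are. -/
theorem exists_equiv_of_slice_det_ne_zero (L : ℝ × ℂ →L[ℝ] ℂ)
    (h : (L.comp (ContinuousLinearMap.inr ℝ ℝ ℂ)).det ≠ 0) :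
    ∃ e : (ℝ × ℂ) ≃L[ℝ] (ℝ × ℂ),
      (e : ℝ × ℂ →L[ℝ] ℝ × ℂ) = (ContinuousLinearMap.fst ℝ ℝ ℂ).prod L := by
  set T := (ContinuousLinearMap.fst ℝ ℝ ℂ).prod L with hT
  have hinj : Function.Injective T := by
    rw [injective_iff_map_eq_zero]
    rintro ⟨s, z⟩ hz
    simp only [hT, ContinuousLinearMap.prod_apply, ContinuousLinearMap.coe_fst',
      Prod.mk_eq_zero] at hz
    obtain ⟨rfl, hz⟩ := hz
    have h1 := ((L.comp (ContinuousLinearMap.inr ℝ ℝ ℂ)).toContinuousLinearEquivOfDetNeZero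
      h).injective
    have h2 : z = 0 := h1 (hz.trans (map_zero _).symm)
    rw [h2]; rfl
  exact ⟨(LinearEquiv.ofInjectiveEndo (T : ℝ × ℂ →ₗ[ℝ] ℝ × ℂ) hinj).toContinuousLinearEquiv, rfl⟩

/-- The family z exp(s g(z)) is treated as one map of (s, z) that preserves s. Injectivity and
invertible derivatives on the compact set [0, 1] × circle extend to a neighbourhood. This gives
uniformity in s and joint continuity of the inverses. -/
theorem exists_isotopy_chart {W : Set ℂ} {g : ℂ → ℂ} {θ q : ℝ → ℝ} (hW : IsOpen W)
    (hKW : coreCircle ⊆ W) (hg : ContDiffOn ℝ ∞ g W)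
    (hgκ : ∀ t : ℝ, g (coreCover t) = 2 * Real.pi * Complex.I * (θ t - t : ℝ))
    (hd : ∀ t, HasDerivAt θ (q t) t) (hq : ∀ t, 0 < q t) (hθ : ∀ t, θ (t + 1) = θ t + 1)
    (hdet : ∀ z ∈ coreCircle, 0 < (fderiv ℝ (fun w => w * Complex.exp (g w)) z).det) :
    ∃ Φ : OpenPartialHomeomorph (ℝ × ℂ) (ℝ × ℂ),
      (∀ p, Φ p = (p.1, p.2 * Complex.exp (p.1 * g p.2))) ∧ Φ.source ⊆ univ ×ˢ W ∧
      Icc (0 : ℝ) 1 ×ˢ coreCircle ⊆ Φ.source ∧ Icc (0 : ℝ) 1 ×ˢ coreCircle ⊆ Φ.target ∧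
      ∀ p ∈ Φ.source, 0 < (fderiv ℝ (fun w => w * Complex.exp (p.1 * g w)) p.2).det := by
  let Ψ : ℝ × ℂ → ℂ := fun p => p.2 * Complex.exp (p.1 * g p.2)
  let f : ℝ × ℂ → ℝ × ℂ := fun p => (p.1, Ψ p)
  have hUW : IsOpen (univ ×ˢ W : Set (ℝ × ℂ)) := isOpen_univ.prod hW
  have hga {z : ℂ} (hz : z ∈ W) : ContDiffAt ℝ ∞ g z := hg.contDiffAt (hW.mem_nhds hz)
  have hΨ {p : ℝ × ℂ} (hp : p.2 ∈ W) : ContDiffAt ℝ ∞ Ψ p := by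
    refine contDiffAt_snd.mul (ContDiffAt.cexp (ContDiffAt.mul ?_ ?_))
    · exact Complex.ofRealCLM.contDiff.contDiffAt.comp p contDiffAt_fst
    · exact ContDiffAt.comp (g := g) p (hga hp) contDiffAt_snd
  let B : ℝ × ℂ → ℂ →L[ℝ] ℂ := fun p => (fderiv ℝ Ψ p).comp (ContinuousLinearMap.inr ℝ ℝ ℂ)
  have hB {p : ℝ × ℂ} (hp : p.2 ∈ W) :
      fderiv ℝ (fun w => w * Complex.exp (p.1 * g w)) p.2 = B p := by
    have h1 : HasFDerivAt Ψ (fderiv ℝ Ψ p) (p.1, p.2) :=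
      ((hΨ hp).differentiableAt (by simp)).hasFDerivAt
    exact (h1.comp p.2 (hasFDerivAt_prodMk_right p.1 p.2)).fderiv
  have hBc {p : ℝ × ℂ} (hp : p.2 ∈ W) : ContinuousAt (fun p => (B p).det) p := by
    refine ContinuousLinearMap.continuous_det.continuousAt.comp ?_
    exact ((hΨ hp).continuousAt_fderiv (by simp)).clm_comp continuousAt_const
  have hstrict {p : ℝ × ℂ} (hp : p.2 ∈ W) (hD : 0 < (B p).det) :
      ∃ e : (ℝ × ℂ) ≃L[ℝ] (ℝ × ℂ), HasStrictFDerivAt f (e : ℝ × ℂ →L[ℝ] ℝ × ℂ) p := by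
    obtain ⟨e, he⟩ := exists_equiv_of_slice_det_ne_zero (fderiv ℝ Ψ p) hD.ne'
    exact ⟨e, he ▸ hasStrictFDerivAt_fst.prodMk ((hΨ hp).hasStrictFDerivAt (by simp))⟩
  have hslice (s t : ℝ) : Ψ (s, coreCover t) = coreCover (((1 - s) * t + s * θ t : ℝ) : ℂ) := by
    have h1 : (((1 - s) * t + s * θ t : ℝ) : ℂ) = t + s * (θ t - t : ℝ) := by push_cast; ring
    rw [h1, coreCover_add]
    simp only [Ψ, hgκ]
    congr 2
    ring
  have hDK : ∀ p ∈ Icc (0 : ℝ) 1 ×ˢ coreCircle, 0 < (B p).det := by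
    rintro ⟨s, z⟩ ⟨⟨hs0, hs1⟩, hz⟩
    have hzW := hKW hz
    rw [← hB (p := (s, z)) hzW]
    have hz' : ‖z‖ = 3 / 2 := hz
    have hz0 : z ≠ 0 := by rw [← norm_pos_iff, hz']; norm_num
    have hgd := ((hga hzW).differentiableAt (by simp)).hasFDerivAt
    obtain ⟨t, rfl⟩ := exists_coreCover_eq hz'
    have hG : fderiv ℝ g (coreCover t) (Complex.I * coreCover t) =
        Complex.I * (q t - 1 : ℝ) := by
      have k1 := hgd.comp_hasDerivAt t (hasDerivAt_coreCover t).comp_ofReal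
      have k2 : HasDerivAt (fun t : ℝ => g (coreCover t))
          (2 * Real.pi * Complex.I * ((q t - 1 : ℝ) : ℂ)) t := by
        have := (((hd t).sub (hasDerivAt_id t)).ofReal_comp).const_mul
          (2 * Real.pi * Complex.I : ℂ)
        exact this.congr_of_eventuallyEq (Filter.Eventually.of_forall fun u => hgκ u)
      have k3 := k1.unique k2
      have k4 : (2 * Real.pi * Complex.I * coreCover t : ℂ) =
          (2 * Real.pi : ℝ) • (Complex.I * coreCover t) := by
        rw [Complex.real_smul]; push_cast; ring
      rw [k4, map_smul, Complex.real_smul] at k3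
      have k5 : ((2 * Real.pi : ℝ) : ℂ) ≠ 0 := by
        exact_mod_cast Real.two_pi_pos.ne'
      apply mul_left_cancel₀ k5
      rw [k3]; push_cast; ring
    have e1 := det_fderiv_mul_exp 1 hz0 hgd hG
    have e2 := hdet _ hz
    simp only [Complex.ofReal_one, one_mul, add_sub_cancel] at e1
    rw [e1] at e2
    have hn (w : ℂ) : 0 < Complex.normSq (Complex.exp w) :=
      Complex.normSq_pos.2 (Complex.exp_ne_zero _)
    -- At s = 1 the positive Jacobian and the positive tangential stretch q force a positive radial
    -- stretch. Both stretches equal 1 at s = 0, so they stay positive in between.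
    have e3 := (pos_iff_pos_of_mul_pos ((pos_iff_pos_of_mul_pos e2).1 (hn _))).1 (hq t)
    rw [det_fderiv_mul_exp s hz0 hgd hG]
    have hs0' : 0 ≤ s := hs0
    have hs1' : s ≤ 1 := hs1
    have hconv {x : ℝ} (hx : 0 < 1 + x) : 0 < 1 + s * x := by
      rcases hs0'.eq_or_lt with h0 | h0
      · subst h0; simp
      · nlinarith [mul_pos h0 hx]
    exact mul_pos (hn _) (mul_pos (hconv (by simpa using hq t)) (hconv e3))
  have hinj : InjOn f (Icc (0 : ℝ) 1 ×ˢ coreCircle) := by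
    rintro ⟨s, z⟩ ⟨hs, hz⟩ ⟨s', z'⟩ ⟨-, hz'⟩ h
    obtain ⟨h1, h2⟩ := Prod.mk.inj h
    have h1' : s = s' := h1
    subst h1'
    obtain ⟨t, rfl⟩ := exists_coreCover_eq hz
    obtain ⟨t', rfl⟩ := exists_coreCover_eq hz'
    simp only [hslice] at h2
    obtain ⟨n, hn⟩ := exists_int_of_coreCover_eq h2
    have hθn (t : ℝ) (n : ℤ) : θ (t + n) = θ t + n := by
      have hper : Function.Periodic (fun u => θ u - u) 1 := fun u => by simp [hθ]
      have := (hper.int_mul n) t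
      simp only [mul_one] at this
      linarith
    have hmono : StrictMono θ := strictMono_of_hasDerivAt_pos hd hq
    -- The lift (1 - s) t + s θ(t) is strictly increasing for s in [0, 1] and commutes with integer
    -- translations.
    have key : t = t' + n := by
      by_contra hne
      have e1 := hθn t' n
      rcases lt_or_gt_of_ne hne with hlt | hlt
      · have := hmono hlt
        rcases hs.1.eq_or_lt with h0 | h0
        · subst h0; linarith
        · nlinarith [hs.2]
      · have := hmono hlt
        rcases hs.1.eq_or_lt with h0 | h0
        · subst h0; linarith
        · nlinarith [hs.2]
    rw [key]
    push_cast
    rw [coreCover_add_int]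
  have hlocal : ∀ p ∈ Icc (0 : ℝ) 1 ×ˢ coreCircle, ∃ u ∈ 𝓝 p, InjOn f u := fun p hp => by
    obtain ⟨e, he⟩ := hstrict (hKW hp.2) (hDK p hp)
    refine ⟨(he.toOpenPartialHomeomorph f).source,
      (he.toOpenPartialHomeomorph f).open_source.mem_nhds
        he.mem_toOpenPartialHomeomorph_source, ?_⟩
    exact (he.toOpenPartialHomeomorph f).injOn
  obtain ⟨T, hT, hTi⟩ := hinj.exists_mem_nhdsSet (isCompact_Icc.prod isCompact_coreCircle)
    (fun p hp => continuousAt_fst.prodMk (hΨ (hKW hp.2)).continuousAt) hlocal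
  have hN : T ∩ univ ×ˢ W ∩ {p | 0 < (B p).det} ∈ 𝓝ˢ (Icc (0 : ℝ) 1 ×ˢ coreCircle) := by
    refine Filter.inter_mem (Filter.inter_mem hT
      (hUW.mem_nhdsSet.2 (prod_mono (subset_univ _) hKW))) ?_
    rw [mem_nhdsSet_iff_forall]
    exact fun p hp => (hBc (hKW hp.2)).eventually (lt_mem_nhds (hDK p hp))
  obtain ⟨U, hU, hcU, hUN⟩ := mem_nhdsSet_iff_exists.1 hN
  obtain ⟨Φ, hs, ht, hΦ⟩ := exists_openPartialHomeomorph_of_injOn hU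
    (hTi.mono fun p hp => (hUN hp).1.1) fun p hp => by
      obtain ⟨e, he⟩ := hstrict (hUN hp).1.2.2 (hUN hp).2
      exact he.map_nhds_eq_of_equiv
  refine ⟨Φ, fun p => by rw [hΦ], hs ▸ fun p hp => (hUN hp).1.2, hs ▸ hcU, ?_, ?_⟩
  · rw [ht]
    rintro ⟨s, z⟩ ⟨hs', hz⟩
    obtain ⟨t, rfl⟩ := exists_coreCover_eq hz
    have hc : Continuous fun u => (1 - s) * u + s * θ u := by
      have : Continuous θ := continuous_iff_continuousAt.2 fun t => (hd t).continuousAt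
      fun_prop
    set a := (1 - s) * 0 + s * θ 0 with ha
    have h1 : (1 - s) * 1 + s * θ 1 = a + 1 := by
      have := hθ 0
      rw [zero_add] at this
      rw [this]; ring
    -- Over one period the interpolated lift increases by exactly 1, so it attains a representative
    -- of t modulo 1.
    obtain ⟨u, -, hu⟩ := intermediate_value_Icc zero_le_one hc.continuousOn
      (show a + Int.fract (t - a) ∈ Icc ((1 - s) * 0 + s * θ 0) ((1 - s) * 1 + s * θ 1) by
        rw [h1]
        exact ⟨by linarith [Int.fract_nonneg (t - a)], by linarith [Int.fract_lt_one (t - a)]⟩)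
    refine ⟨(s, coreCover u), hcU ⟨hs', norm_coreCover_ofReal u⟩, ?_⟩
    refine Prod.ext rfl ?_
    change Ψ (s, coreCover u) = coreCover t
    simp only at hu
    rw [hslice, hu, ← coreCover_add_int _ ⌊t - a⌋]
    congr 1
    have := Int.fract_add_floor (t - a)
    have h2 : a + Int.fract (t - a) + ⌊t - a⌋ = t := by linarith
    exact_mod_cast h2
  · intro p hp
    rw [hs] at hp
    rw [hB (hUN hp).1.2.2]
    exact (hUN hp).2

/-! ### Twist profiles -/

/-- A smooth step from `1` to `2` in the interval of radius `ε` around `3 / 2`. -/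
def thinProfile (ε r : ℝ) : ℝ := 1 + Real.smoothTransition ((r - (3 / 2 - ε)) / (2 * ε))

theorem contDiff_thinProfile (ε : ℝ) : ContDiff ℝ ∞ (thinProfile ε) :=
  contDiff_const.add (Real.smoothTransition.contDiff.comp
    ((contDiff_id.sub contDiff_const).div_const _))

theorem thinProfile_eq_one {ε r : ℝ} (hε : 0 < ε) (h : r ≤ 3 / 2 - ε) : thinProfile ε r = 1 := by
  rw [thinProfile, Real.smoothTransition.zero_of_nonpos, add_zero]
  exact div_nonpos_of_nonpos_of_nonneg (by linarith) (by linarith)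

theorem thinProfile_eq_two {ε r : ℝ} (hε : 0 < ε) (h : 3 / 2 + ε ≤ r) : thinProfile ε r = 2 := by
  rw [thinProfile, Real.smoothTransition.one_of_one_le]
  · norm_num
  · rw [one_le_div (by linarith)]; linarith

/-- A twist profile that need only be smooth at positive radii. -/
structure IsStep (f : ℝ → ℝ) : Prop where
  smooth : ∀ r, 0 < r → ContDiffAt ℝ ∞ f r
  eq_one : ∀ᶠ r in 𝓝 1, f r = 1
  eq_two : ∀ᶠ r in 𝓝 2, f r = 2

theorem IsTwistProfile.isStep {f : ℝ → ℝ} (h : IsTwistProfile f) : IsStep f :=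
  ⟨fun _ _ => h.smooth.contDiffAt, h.eq_one, h.eq_two⟩

theorem isStep_thinProfile {ε : ℝ} (hε : 0 < ε) (h : ε < 1 / 2) : IsStep (thinProfile ε) where
  smooth r _ := (contDiff_thinProfile ε).contDiffAt
  eq_one := by
    filter_upwards [Iio_mem_nhds (show (1 : ℝ) < 3 / 2 - ε by linarith)] with r hr
    exact thinProfile_eq_one hε (le_of_lt hr)
  eq_two := by
    filter_upwards [Ioi_mem_nhds (show 3 / 2 + ε < (2 : ℝ) by linarith)] with r hr
    exact thinProfile_eq_two hε (le_of_lt hr)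

/-- This is the thin profile seen through the inversion (9/4)/z, which exchanges the radii near 1
and near 2. The singularity at 0 is the reason why steps are smooth at positive radii only. -/
theorem isStep_reverse_thinProfile {ε : ℝ} (hε : 0 < ε) (h : ε < 1 / 4) :
    IsStep (fun r => 3 - thinProfile ε (9 / 4 / r)) where
  smooth r hr := contDiffAt_const.sub ((contDiff_thinProfile ε).contDiffAt.comp r
    (contDiffAt_const.div contDiffAt_id hr.ne'))
  eq_one := by
    -- For r < 9/7 the inverted radius exceeds 7/4 > 3/2 + ε; for r > 9/5 below, it is less than 5/4
    -- < 3/2 - ε.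
    filter_upwards [Ioo_mem_nhds (show (0 : ℝ) < 1 by norm_num)
      (show (1 : ℝ) < 9 / 7 by norm_num)] with r hr
    rw [thinProfile_eq_two hε]
    · norm_num
    · rw [le_div_iff₀ hr.1]
      nlinarith [hr.1, hr.2]
  eq_two := by
    filter_upwards [Ioi_mem_nhds (show (9 / 5 : ℝ) < 2 by norm_num)] with r hr
    have hr' : 9 / 5 < r := hr
    rw [thinProfile_eq_one hε]
    · norm_num
    · rw [div_le_iff₀ (by linarith)]
      nlinarith

/-! ### Independence of the twist class from collar and profile -/

section

variable {S : Type*} [TopologicalSpace S] [ChartedSpace ℂ S]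

theorem IsOrientedChart.jacobian_symm_pos {φ : OpenPartialHomeomorph S ℂ} (h : IsOrientedChart φ)
    {z : ℂ} (hz : z ∈ φ.target) : 0 < surfaceJacobian φ.symm z := by
  have h4 := surfaceJacobian_symm_mul φ h.smooth h.smooth_symm (φ.map_target hz)
  rw [φ.right_inv hz] at h4
  exact pos_of_mul_pos_left (h4 ▸ one_pos) (h.jacobian_pos _ (φ.map_target hz)).le

theorem IsBicollar.isOrientedChart {φ : OpenPartialHomeomorph S ℂ} {c : SimpleClosedCurve S}
    (h : IsBicollar φ c) : IsOrientedChart φ :=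
  ⟨h.smooth, h.smooth_symm, h.jacobian_pos⟩

/-- Step profiles on a bicollar are constant outside of a common compact annulus. -/
theorem IsBicollar.exists_isTwistable {φ : OpenPartialHomeomorph S ℂ} {c : SimpleClosedCurve S}
    (h : IsBicollar φ c) {f g : ℝ → ℝ} (hf : IsStep f) (hg : IsStep g) :
    ∃ a b, IsTwistable φ f a b ∧ IsTwistable φ g a b ∧
      ∀ z ∈ φ.target, z ∉ closedAnnulus a b → f ‖z‖ = g ‖z‖ := by
  obtain ⟨η, hη, h1⟩ := Metric.eventually_nhds_iff.1 (hf.eq_one.and hg.eq_one)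
  obtain ⟨ζ, hζ, h2⟩ := Metric.eventually_nhds_iff.1 (hf.eq_two.and hg.eq_two)
  have key {z : ℂ} (hz : z ∈ φ.target) (hz' : z ∉ closedAnnulus (1 + η / 2) (2 - ζ / 2)) :
      (f ‖z‖ = 1 ∧ g ‖z‖ = 1) ∨ (f ‖z‖ = 2 ∧ g ‖z‖ = 2) := by
    rw [h.target_eq] at hz
    obtain ⟨hz1, hz2⟩ := hz
    simp only [closedAnnulus, mem_ofPred_eq, not_and_or, not_le] at hz'
    rcases hz' with hz' | hz'
    · left
      apply h1
      rw [Real.dist_eq, abs_lt]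
      constructor <;> linarith
    · right
      apply h2
      rw [Real.dist_eq, abs_lt]
      constructor <;> linarith
  have hsub : closedAnnulus (1 + η / 2) (2 - ζ / 2) ⊆ φ.target := by
    rw [h.target_eq]
    rintro z ⟨hz1, hz2⟩
    constructor <;> linarith
  refine ⟨1 + η / 2, 2 - ζ / 2, ⟨by positivity, hsub, hf.smooth, fun z hz hz' => ?_⟩,
    ⟨by positivity, hsub, hg.smooth, fun z hz hz' => ?_⟩, fun z hz hz' => ?_⟩
  · rcases key hz hz' with h | h
    · exact ⟨1, by simp [h.1]⟩
    · exact ⟨2, by simp [h.1]⟩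
  · rcases key hz hz' with h | h
    · exact ⟨1, by simp [h.2]⟩
    · exact ⟨2, by simp [h.2]⟩
  · rcases key hz hz' with h | h <;> rw [h.1, h.2]

theorem IsBicollar.joined_of_isStep [T2Space S] [IsManifold 𝓘(ℝ, ℂ) ∞ S]
    {φ : OpenPartialHomeomorph S ℂ} {c : SimpleClosedCurve S}
    (h : IsBicollar φ c) {f g : ℝ → ℝ} (hf : IsStep f) (hg : IsStep g)
    {t₀ t₁ : OrientedDiffeo S} (ht₀ : ∀ x, t₀ x = twistMap φ f x)
    (ht₁ : ∀ x, t₁ x = twistMap φ g x) : Joined t₀ t₁ := by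
  obtain ⟨a, b, h1, h2, h3⟩ := h.exists_isTwistable hf hg
  exact joined_of_profiles h.isOrientedChart h1 h2 h3 ht₀ ht₁

/-- Bicollars and their restrictions and reversals: oriented charts that map the curve `c` onto the
core circle. -/
structure IsCollar (φ : OpenPartialHomeomorph S ℂ) (c : Set S) : Prop
    extends IsOrientedChart φ where
  subset_source : c ⊆ φ.source
  image_eq : φ '' c = coreCircle

theorem IsBicollar.isCollar {φ : OpenPartialHomeomorph S ℂ} {c : SimpleClosedCurve S}
    (h : IsBicollar φ c) : IsCollar φ c.carrier :=
  ⟨h.isOrientedChart, h.subset_source, h.image_eq⟩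

section Transition

variable {φ₀ φ₁ : OpenPartialHomeomorph S ℂ} {c : Set S}

theorem IsOrientedChart.contDiffOn_transition (h₀ : IsOrientedChart φ₀)
    (h₁ : IsOrientedChart φ₁) :
    ContDiffOn ℝ ∞ (φ₁ ∘ φ₀.symm) (φ₀.symm.trans φ₁).source := by
  rw [← contMDiffOn_iff_contDiffOn]
  refine h₁.smooth.comp (h₀.smooth_symm.mono ?_) ?_
  · exact fun z hz => hz.1
  · exact fun z hz => hz.2

theorem IsOrientedChart.det_transition_pos (h₀ : IsOrientedChart φ₀) (h₁ : IsOrientedChart φ₁)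
    {z : ℂ} (hz : z ∈ (φ₀.symm.trans φ₁).source) :
    0 < (fderiv ℝ (φ₁ ∘ φ₀.symm) z).det := by
  have k1 : MDifferentiableAt 𝓘(ℝ, ℂ) 𝓘(ℝ, ℂ) φ₁ (φ₀.symm z) :=
    (h₁.smooth.contMDiffAt (φ₁.open_source.mem_nhds hz.2)).mdifferentiableAt (by simp)
  have k2 := (h₀.smooth_symm.contMDiffAt (φ₀.open_target.mem_nhds hz.1)).mdifferentiableAt
    (by simp)
  rw [← surfaceJacobian_eq_fderiv, surfaceJacobian_comp k1 k2]
  exact mul_pos (h₁.jacobian_pos _ hz.2) (h₀.jacobian_symm_pos hz.1)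

theorem IsCollar.coreCircle_subset (h₀ : IsCollar φ₀ c) (h₁ : IsCollar φ₁ c) :
    coreCircle ⊆ (φ₀.symm.trans φ₁).source := by
  rw [← h₀.image_eq]
  rintro _ ⟨x, hx, rfl⟩
  refine ⟨φ₀.map_source (h₀.subset_source hx), ?_⟩
  simp only [mem_preimage]
  erw [φ₀.left_inv (h₀.subset_source hx)]
  exact h₁.subset_source hx

theorem IsCollar.transition_mem (h₀ : IsCollar φ₀ c) (h₁ : IsCollar φ₁ c) {z : ℂ}
    (hz : z ∈ coreCircle) : φ₁ (φ₀.symm z) ∈ coreCircle := by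
  rw [← h₀.image_eq] at hz
  obtain ⟨x, hx, rfl⟩ := hz
  rw [φ₀.left_inv (h₀.subset_source hx), ← h₁.image_eq]
  exact mem_image_of_mem _ hx

/-- The transition between two collars of the same curve, lifted to the line. -/
theorem IsCollar.exists_lift (h₀ : IsCollar φ₀ c) (h₁ : IsCollar φ₁ c) :
    ∃ θ q : ℝ → ℝ, (∀ t, HasDerivAt θ (q t) t) ∧
      (∀ t : ℝ, φ₁ (φ₀.symm (coreCover t)) = coreCover (θ t)) ∧
      ((∀ t, 0 < q t) ∨ ∀ t, q t < 0) := by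
  set ψ : ℂ → ℂ := φ₁ ∘ φ₀.symm
  have hK (t : ℝ) := h₀.coreCircle_subset h₁ (norm_coreCover_ofReal t)
  have hψ (t : ℝ) : ContDiffAt ℝ ∞ ψ (coreCover t) :=
    (h₀.contDiffOn_transition h₁.toIsOrientedChart).contDiffAt
      ((φ₀.symm.trans φ₁).open_source.mem_nhds (hK t))
  have hκ : ContDiff ℝ ∞ fun t : ℝ => coreCover t :=
    contDiff_coreCover.comp Complex.ofRealCLM.contDiff
  have hη : ContDiff ℝ ∞ fun t : ℝ => ψ (coreCover t) :=
    contDiff_iff_contDiffAt.2 fun t =>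
      ContDiffAt.comp (g := ψ) (f := fun t : ℝ => coreCover t) t (hψ t) hκ.contDiffAt
  refine exists_coreCover_lift (η := fun t : ℝ => ψ (coreCover t))
    (fun t => (hη.differentiable (by simp) t).hasDerivAt) (hη.continuous_deriv (by simp))
    (fun t => h₀.transition_mem h₁ (norm_coreCover_ofReal t)) fun t h0 => ?_
  have k1 := ((hψ t).differentiableAt (by simp)).hasFDerivAt.comp_hasDerivAt t
    (hasDerivAt_coreCover t).comp_ofReal
  have k2 : fderiv ℝ ψ (coreCover t) (2 * Real.pi * Complex.I * coreCover t) = 0 :=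
    k1.deriv.symm.trans h0
  -- The transition has invertible derivative, so the image of a regular curve has nonzero velocity.
  have k3 := h₀.det_transition_pos h₁.toIsOrientedChart (hK t)
  have k4 := ((fderiv ℝ ψ (coreCover t)).toContinuousLinearEquivOfDetNeZero k3.ne').injective
  have k5 := k4 (k2.trans (map_zero (fderiv ℝ ψ (coreCover t))).symm)
  exact mul_ne_zero Complex.two_pi_I_ne_zero (coreCover_ne_zero _) k5

/-- The annulus that supports the twist already lies in the smaller chart, so both twists are the
identity elsewhere. The ends of the isotopy of collars are only restrictions of the given ones. -/
theorem twistMap_eq_of_restriction {φ φ' : OpenPartialHomeomorph S ℂ} {f : ℝ → ℝ} {a b : ℝ}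
    (hs : φ'.source ⊆ φ.source) (he : EqOn φ' φ φ'.source) (h : IsTwistable φ f a b)
    (h' : IsTwistable φ' f a b) (x : S) : twistMap φ' f x = twistMap φ f x := by
  have hsymm {z : ℂ} (hz : z ∈ φ'.target) : φ'.symm z = φ.symm z := by
    have h1 := φ'.map_target hz
    have h2 : φ (φ'.symm z) = z := by rw [← he h1, φ'.right_inv hz]
    rw [← h2, φ.left_inv (hs h1), h2]
  by_cases hx : x ∈ φ'.source
  · rw [twistMap_of_mem x hx, twistMap_of_mem x (hs hx), hsymm (h'.rotation_mem (φ'.map_source hx)),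
      he hx]
  · rw [twistMap_of_notMem x hx, h.twistMap_eq_self]
    rintro ⟨z, hz, rfl⟩
    rw [← hsymm (h'.subset hz)] at hx
    exact hx (φ'.map_target (h'.subset hz))

theorem isTwistable_thinProfile {φ : OpenPartialHomeomorph S ℂ} {ε : ℝ} (hε : 0 < ε)
    (hε' : ε < 3 / 2) (h : closedAnnulus (3 / 2 - ε) (3 / 2 + ε) ⊆ φ.target) :
    IsTwistable φ (thinProfile ε) (3 / 2 - ε) (3 / 2 + ε) where
  pos := by linarith
  subset := h
  smooth _ _ := (contDiff_thinProfile ε).contDiffAt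
  int z _ hz := by
    simp only [closedAnnulus, mem_ofPred_eq, not_and_or, not_le] at hz
    rcases hz with hz | hz
    · exact ⟨1, by rw [thinProfile_eq_one hε hz.le]; simp⟩
    · exact ⟨2, by rw [thinProfile_eq_two hε hz.le]; simp⟩

/-- Thin twists in collars that traverse the curve in the same direction are isotopic. -/
theorem IsCollar.exists_joined [T2Space S] [OrientedSurface S] (h₀ : IsCollar φ₀ c)
    (h₁ : IsCollar φ₁ c) {θ q : ℝ → ℝ} (hd : ∀ t, HasDerivAt θ (q t) t) (hq : ∀ t, 0 < q t)
    (hlift : ∀ t : ℝ, φ₁ (φ₀.symm (coreCover t)) = coreCover (θ t)) :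
    ∃ δ > 0, ∀ ε, 0 < ε → ε < δ → ∀ t₀ t₁ : OrientedDiffeo S,
      (∀ x, t₀ x = twistMap φ₀ (thinProfile ε) x) →
      (∀ x, t₁ x = twistMap φ₁ (thinProfile ε) x) → Joined t₀ t₁ := by
  -- The inverse is a total function, so its value at 0 is a point of the surface even if 0 is not
  -- in the target.
  have hne : Nonempty S := ⟨φ₀.symm 0⟩
  have hmono : StrictMono θ := strictMono_of_hasDerivAt_pos hd hq
  have hcont : Continuous θ := continuous_iff_continuousAt.2 fun t => (hd t).continuousAt
  have hV0 := h₀.coreCircle_subset h₁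
  have hi : InjOn (φ₁ ∘ φ₀.symm) (φ₀.symm.trans φ₁).source := (φ₀.symm.trans φ₁).injOn
  have hθ : ∀ t, θ (t + 1) = θ t + 1 := by
    refine lift_add_one hmono hcont (fun t => ?_) fun t t' h => ?_
    · rw [← hlift, ← hlift]
      have := coreCover_add_int t 1
      push_cast at this ⊢
      rw [this]
    · rw [← hlift, ← hlift] at h
      exact exists_int_of_coreCover_eq
        (hi (hV0 (norm_coreCover_ofReal t)) (hV0 (norm_coreCover_ofReal t')) h)
  obtain ⟨W, g, hW, hKW, hWV, hg, hexp, hgκ⟩ := exists_log_quotient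
    (φ₀.symm.trans φ₁).open_source hV0 (h₀.contDiffOn_transition h₁.toIsOrientedChart) hcont hθ
    hlift
  obtain ⟨Φ, hΦ, hsW, hKs, hKt, hdet⟩ := exists_isotopy_chart hW hKW hg hgκ hd hq hθ fun z hz => by
    have : (fun w => w * Complex.exp (g w)) =ᶠ[𝓝 z] φ₁ ∘ φ₀.symm := by
      filter_upwards [hW.mem_nhds (hKW hz)] with w hw using hexp w hw
    rw [this.fderiv_eq]
    exact h₀.det_transition_pos h₁.toIsOrientedChart (hV0 hz)
  -- the isotopy of collars
  let f : ℝ → S → ℂ := fun s x => φ₀ x * Complex.exp (s * g (φ₀ x))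
  let U : ℝ → Set S := fun s => φ₀.source ∩ φ₀ ⁻¹' {z | (s, z) ∈ Φ.source}
  have hΦf (s : ℝ) (x : S) : Φ (s, φ₀ x) = (s, f s x) := hΦ _
  have hslice : ∀ s, ∃ φ : OpenPartialHomeomorph S ℂ, IsOrientedChart φ ∧ φ.source = U s ∧
      φ.target = f s '' U s ∧ ⇑φ = f s := by
    intro s
    have hU : IsOpen (U s) :=
      φ₀.isOpen_inter_preimage (Φ.open_source.preimage (Continuous.prodMk_right s))
    have hgs {x : S} (hx : x ∈ U s) :
        ContDiffAt ℝ ∞ (fun w => w * Complex.exp (s * g w)) (φ₀ x) := by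
      have hxW : φ₀ x ∈ W := (hsW hx.2).2
      exact contDiffAt_id.mul (contDiffAt_const.mul (hg.contDiffAt (hW.mem_nhds hxW))).cexp
    have hφ₀ {x : S} (hx : x ∈ U s) := h₀.smooth.contMDiffAt (φ₀.open_source.mem_nhds hx.1)
    refine exists_isOrientedChart_of_injOn hU (fun x hx => ?_) ?_ fun x hx => ?_
    · exact ((hgs hx).contMDiffAt.comp x (hφ₀ hx)).contMDiffWithinAt
    · intro x hx y hy hxy
      have h1 : Φ (s, φ₀ x) = Φ (s, φ₀ y) := by rw [hΦf, hΦf, hxy]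
      exact φ₀.injOn hx.1 hy.1 (Prod.mk.inj (Φ.injOn hx.2 hy.2 h1)).2
    · have k := surfaceJacobian_comp (f := fun w => w * Complex.exp (s * g w)) (g := φ₀) (x := x)
        ((hgs hx).contMDiffAt.mdifferentiableAt (by simp)) ((hφ₀ hx).mdifferentiableAt (by simp))
      refine lt_of_lt_of_eq (mul_pos ?_ (h₀.jacobian_pos x hx.1)) k.symm
      rw [surfaceJacobian_eq_fderiv]
      exact hdet _ hx.2
  choose φ hφ hφs hφt hφf using hslice
  -- The inverse of each slice is read off from the inverse of the total map, hence is jointly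
  -- continuous in s and w.
  have htarget {s : ℝ} {w : ℂ} (hw : (s, w) ∈ Φ.target) :
      w ∈ (φ s).target ∧ (φ s).symm w = φ₀.symm (Φ.symm (s, w)).2 := by
    have h1 := Φ.map_target hw
    have h2 := Φ.right_inv hw
    rw [hΦ] at h2
    obtain ⟨h3, h4⟩ := Prod.mk.inj h2
    have h5 : (Φ.symm (s, w)).2 ∈ φ₀.target := (hWV (hsW h1).2).1
    have h6 : φ₀ (φ₀.symm (Φ.symm (s, w)).2) = (Φ.symm (s, w)).2 := φ₀.right_inv h5
    have h7 : φ₀.symm (Φ.symm (s, w)).2 ∈ U s := by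
      refine ⟨φ₀.map_target h5, ?_⟩
      rw [mem_preimage, h6, mem_ofPred_eq]
      have h8 : (s, (Φ.symm (s, w)).2) = Φ.symm (s, w) := Prod.ext h3.symm rfl
      rw [h8]
      exact h1
    have h8 : φ s (φ₀.symm (Φ.symm (s, w)).2) = w := by
      rw [hφf]
      simp only [f, h6]
      rw [h3] at h4
      exact h4
    rw [← hφs] at h7
    refine ⟨h8 ▸ (φ s).map_source h7, ?_⟩
    rw [← (φ s).left_inv h7, h8]
  have htarget' {s : ℝ} {w : ℂ} (hw : w ∈ (φ s).target) : (s, w) ∈ Φ.target := by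
    rw [hφt] at hw
    obtain ⟨x, hx, rfl⟩ := hw
    rw [← hΦf]
    exact Φ.map_source hx.2
  obtain ⟨δ, hδ, hA⟩ := exists_prod_annulus_subset Φ.open_target hKt
  refine ⟨min δ (3 / 2), by positivity, fun ε hε hεδ t₀ t₁ ht₀ ht₁ => ?_⟩
  have hC : ∀ s ∈ Icc (0 : ℝ) 1, closedAnnulus (3 / 2 - ε) (3 / 2 + ε) ⊆ (φ s).target :=
    fun s hs w hw => (htarget (hA s hs w (by
      have := hεδ.trans_le (min_le_left _ _)
      rw [abs_lt]
      constructor <;> linarith [hw.1, hw.2]))).1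
  have hε' := hεδ.trans_le (min_le_right _ _)
  have hT := fun s (hs : s ∈ Icc (0 : ℝ) 1) => isTwistable_thinProfile hε hε' (hC s hs)
  have hrestr {s : ℝ} (hs : s ∈ Icc (0 : ℝ) 1) {φ' : OpenPartialHomeomorph S ℂ}
      (h1 : (φ s).source ⊆ φ'.source) (h2 : EqOn (φ s) φ' (φ s).source) (x : S) :
      twistMap (φ s) (thinProfile ε) x = twistMap φ' (thinProfile ε) x := by
    refine twistMap_eq_of_restriction h1 h2 (isTwistable_thinProfile hε hε' fun w hw => ?_)
      (hT s hs) x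
    have h3 := hC s hs hw
    have h4 := (φ s).map_target h3
    rw [← (φ s).right_inv h3, h2 h4]
    exact φ'.map_source (h1 h4)
  refine joined_of_twist_family (φ := φ) (F := fun _ => thinProfile ε) (fun s _ => hφ s) hT
    ?_ ?_ ?_ ?_ (fun x => ?_) (fun x => ?_)
  · exact fun s _ r _ => ((contDiff_thinProfile ε).continuous.comp continuous_snd).continuousAt
  · intro s _ x hx
    rw [hφs] at hx
    have k1 : ContinuousAt (fun p : ℝ × S => (p.1, φ₀ p.2)) (s, x) :=
      continuousAt_fst.prodMk (ContinuousAt.comp (g := φ₀) (φ₀.continuousAt hx.1) continuousAt_snd)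
    filter_upwards [k1.eventually (Φ.open_source.mem_nhds hx.2),
      continuousAt_snd.eventually (φ₀.open_source.mem_nhds hx.1)] with p hp1 hp2
    rw [hφs]
    exact ⟨hp2, hp1⟩
  · intro s _ x hx
    rw [hφs] at hx
    simp only [hφf]
    have k1 : ContinuousAt (fun p : ℝ × S => (p.1, φ₀ p.2)) (s, x) :=
      continuousAt_fst.prodMk (ContinuousAt.comp (g := φ₀) (φ₀.continuousAt hx.1) continuousAt_snd)
    have k2 := (ContinuousAt.comp (g := Φ) (f := fun p : ℝ × S => (p.1, φ₀ p.2)) (x := (s, x))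
      (Φ.continuousAt hx.2) k1).snd
    refine k2.congr (Filter.Eventually.of_forall fun p => ?_)
    simp only [Function.comp_apply, hΦf]
  · intro s _ w hw
    have hw' := htarget' hw
    have h1 := Φ.map_target hw'
    have h5 : (Φ.symm (s, w)).2 ∈ φ₀.target := (hWV (hsW h1).2).1
    have k1 := (Φ.continuousAt_symm hw').snd
    have k2 : ContinuousAt (fun p : ℝ × ℂ => φ₀.symm (Φ.symm p).2) (s, w) :=
      ContinuousAt.comp (g := φ₀.symm) (φ₀.continuousAt_symm h5) k1
    refine k2.congr ?_
    filter_upwards [Φ.open_target.mem_nhds hw'] with p hp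
    exact (htarget (s := p.1) (w := p.2) hp).2.symm
  · rw [ht₀]
    refine (hrestr (by simp) ?_ ?_ x).symm
    · rw [hφs]; exact inter_subset_left
    · intro y _
      rw [hφf]
      simp [f]
  · rw [ht₁]
    -- At s = 1 the map z exp(g(z)) is the transition itself, so the slice is a restriction of `φ₁`.
    have k {y : S} (hy : y ∈ U 1) : φ₀ y ∈ W := (hsW hy.2).2
    refine (hrestr (by simp) ?_ ?_ x).symm
    · rw [hφs]
      intro y hy
      have : φ₀.symm (φ₀ y) ∈ φ₁.source := (hWV (k hy)).2
      rwa [φ₀.left_inv hy.1] at this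
    · intro y hy
      rw [hφs] at hy
      rw [hφf]
      have := hexp _ (k hy)
      simp only [Function.comp_apply, φ₀.left_inv hy.1] at this
      simpa [f] using this

/-- The reversal of a collar, which traverses the curve in the opposite direction. -/
theorem IsCollar.exists_reverse [OrientedSurface S] (h₁ : IsCollar φ₁ c)
    (h0 : (0 : ℂ) ∉ φ₁.target) :
    ∃ φ : OpenPartialHomeomorph S ℂ, IsCollar φ c ∧ φ.source = φ₁.source ∧
      ∀ x, φ x = 9 / 4 / φ₁ x := by
  have hne : Nonempty S := ⟨φ₁.symm 0⟩
  have hx0 {x : S} (hx : x ∈ φ₁.source) : φ₁ x ≠ 0 := fun h => h0 (h ▸ φ₁.map_source hx)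
  let r : ℂ → ℂ := fun z => 9 / 4 / z
  have hr {z : ℂ} (hz : z ≠ 0) : HasDerivAt r (-(9 / 4) / z ^ 2) z := by
    have := (hasDerivAt_inv hz).const_mul (9 / 4 : ℂ)
    refine (this.congr_of_eventuallyEq
      (Filter.Eventually.of_forall fun w => div_eq_mul_inv _ _)).congr_deriv ?_
    ring
  have hrs {z : ℂ} (hz : z ≠ 0) : ContDiffAt ℝ ∞ r z := by
    have : r = fun z => (9 / 4 : ℂ) * z⁻¹ := funext fun z => div_eq_mul_inv _ _
    rw [this]
    exact contDiffAt_const.mul (contDiffAt_id.inv hz)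
  have hφ₁ {x : S} (hx : x ∈ φ₁.source) := h₁.smooth.contMDiffAt (φ₁.open_source.mem_nhds hx)
  obtain ⟨φ, hφ, hs, -, hφf⟩ := exists_isOrientedChart_of_injOn (f := r ∘ φ₁) φ₁.open_source
    (fun x hx => ((hrs (hx0 hx)).contMDiffAt.comp x (hφ₁ hx)).contMDiffWithinAt)
    (fun x hx y hy hxy => φ₁.injOn hx hy (by
      have h1 := hx0 hx
      have h2 := hx0 hy
      simp only [r, Function.comp_apply] at hxy
      rw [div_eq_div_iff h1 h2] at hxy
      exact (mul_left_cancel₀ (by norm_num) hxy).symm))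
    (fun x hx => by
      rw [surfaceJacobian_comp ((hrs (hx0 hx)).contMDiffAt.mdifferentiableAt (by simp))
        ((hφ₁ hx).mdifferentiableAt (by simp)), surfaceJacobian_eq_fderiv,
        det_fderiv_of_hasDerivAt (hr (hx0 hx))]
      have := hx0 hx
      refine mul_pos (pow_pos (norm_pos_iff.2 ?_) 2) (h₁.jacobian_pos x hx)
      exact div_ne_zero (by norm_num) (pow_ne_zero 2 this))
  refine ⟨φ, ⟨hφ, hs ▸ h₁.subset_source, ?_⟩, hs, fun x => by rw [hφf]; rfl⟩
  rw [hφf, image_comp, h₁.image_eq]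
  ext z
  constructor
  · rintro ⟨w, hw, rfl⟩
    have hw' : ‖w‖ = 3 / 2 := hw
    simp only [coreCircle, mem_ofPred_eq, r, norm_div, hw']
    norm_num
  · intro hz
    have hz' : ‖z‖ = 3 / 2 := hz
    have hz0 : z ≠ 0 := by rw [← norm_pos_iff, hz']; norm_num
    refine ⟨9 / 4 / z, ?_, ?_⟩
    · simp only [coreCircle, mem_ofPred_eq, norm_div, hz']
      norm_num
    · simp only [r]
      field_simp

/-- Inversion negates angles, so rotation by f becomes rotation by -f at the inverted radius. Adding
3 full turns changes nothing and makes the profile rise from 1 to 2 again. Thus the sign of a twist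
does not depend on a direction of the curve. -/
theorem twistMap_reverse {φ φ₁ : OpenPartialHomeomorph S ℂ} (hs : φ.source = φ₁.source)
    (h : ∀ x, φ x = 9 / 4 / φ₁ x) {f : ℝ → ℝ} {a b : ℝ}
    (hT : IsTwistable φ₁ (fun r => 3 - f (9 / 4 / r)) a b) (x : S) :
    twistMap φ f x = twistMap φ₁ (fun r => 3 - f (9 / 4 / r)) x := by
  by_cases hx : x ∈ φ₁.source
  · have hx' : x ∈ φ.source := hs ▸ hx
    have h1 := hT.rotation_mem (φ₁.map_source hx)
    rw [twistMap_of_mem x hx', twistMap_of_mem x hx]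
    set w := radialRotation (fun r => 3 - f (9 / 4 / r)) (φ₁ x) with hw
    have h2 : φ (φ₁.symm w) = radialRotation f (φ x) := by
      rw [h, φ₁.right_inv h1, h, hw, radialRotation, radialRotation, norm_div]
      have h3 : ‖(9 / 4 : ℂ)‖ = 9 / 4 := by norm_num
      rw [h3]
      set F := f (9 / 4 / ‖φ₁ x‖)
      have h4 : (((2 * Real.pi * (3 - F) : ℝ) : ℂ) * Complex.I) =
          (3 : ℤ) * (2 * Real.pi * Complex.I) - ((2 * Real.pi * F : ℝ) : ℂ) * Complex.I := by
        push_cast; ring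
      rw [h4, Complex.exp_sub, Complex.exp_int_mul_two_pi_mul_I]
      have := Complex.exp_ne_zero (((2 * Real.pi * F : ℝ) : ℂ) * Complex.I)
      rw [mul_one_div, div_div_eq_mul_div, mul_div_right_comm]
    rw [← h2]
    exact φ.left_inv (hs ▸ φ₁.map_target h1)
  · rw [twistMap_of_notMem x hx, twistMap_of_notMem x (hs ▸ hx)]

end Transition

/-- Any two positive twists about a curve are isotopic. -/
theorem joined_of_isPositiveDehnTwist [T2Space S] [OrientedSurface S] {c : SimpleClosedCurve S}
    {t₀ t₁ : OrientedDiffeo S} (h₀ : IsPositiveDehnTwist t₀ c) (h₁ : IsPositiveDehnTwist t₁ c) :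
    Joined t₀ t₁ := by
  obtain ⟨φ₀, f₀, hφ₀, hf₀, ht₀⟩ := h₀
  obtain ⟨φ₁, f₁, hφ₁, hf₁, ht₁⟩ := h₁
  have h1 (φ : OpenPartialHomeomorph S ℂ) (hφ : IsBicollar φ c) (f : ℝ → ℝ) (hf : IsStep f) :
      ∃ t : OrientedDiffeo S, ∀ x, t x = twistMap φ f x := by
    obtain ⟨a, b, hT, -⟩ := hφ.exists_isTwistable hf hf
    exact ⟨hT.diffeo hφ.isOrientedChart, fun _ => rfl⟩
  obtain ⟨θ, q, hd, hlift, hq | hq⟩ := hφ₀.isCollar.exists_lift hφ₁.isCollar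
  · obtain ⟨δ, hδ, hJ⟩ := hφ₀.isCollar.exists_joined hφ₁.isCollar hd hq hlift
    obtain ⟨ε, hε, hεδ⟩ := exists_between (lt_min hδ (show (0 : ℝ) < 1 / 4 by norm_num))
    have hstep := isStep_thinProfile hε (by linarith [hεδ.trans_le (min_le_right _ _)])
    obtain ⟨u₀, hu₀⟩ := h1 φ₀ hφ₀ _ hstep
    obtain ⟨u₁, hu₁⟩ := h1 φ₁ hφ₁ _ hstep
    exact ((hφ₀.joined_of_isStep hf₀.isStep hstep ht₀ hu₀).trans
      (hJ ε hε (hεδ.trans_le (min_le_left _ _)) u₀ u₁ hu₀ hu₁)).trans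
      (hφ₁.joined_of_isStep hstep hf₁.isStep hu₁ ht₁)
  · obtain ⟨φ, hφ, hs, hφx⟩ := hφ₁.isCollar.exists_reverse (by simp [hφ₁.target_eq])
    -- The constant 9/4 is the square of the core radius, so the inversion acts on the core circle
    -- as t ↦ -t.
    have hlift' (t : ℝ) : φ (φ₀.symm (coreCover t)) = coreCover ((-θ t : ℝ) : ℂ) := by
      rw [hφx, hlift, div_eq_iff (coreCover_ne_zero _)]
      simp only [coreCover]
      rw [mul_mul_mul_comm, ← Complex.exp_add]
      push_cast
      rw [mul_neg, neg_add_cancel, Complex.exp_zero]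
      norm_num
    obtain ⟨δ, hδ, hJ⟩ := hφ₀.isCollar.exists_joined hφ (fun t => (hd t).neg)
      (fun t => by simpa using hq t) hlift'
    -- The bound 1/4 is what the reversed thin profile needs to be a step.
    obtain ⟨ε, hε, hεδ⟩ := exists_between (lt_min hδ (show (0 : ℝ) < 1 / 4 by norm_num))
    have hε4 := hεδ.trans_le (min_le_right _ _)
    have hstep := isStep_thinProfile hε (by linarith)
    have hstep' := isStep_reverse_thinProfile hε hε4
    obtain ⟨u₀, hu₀⟩ := h1 φ₀ hφ₀ _ hstep
    obtain ⟨u₁, hu₁⟩ := h1 φ₁ hφ₁ _ hstep'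
    obtain ⟨a, b, hT, -⟩ := hφ₁.exists_isTwistable hstep' hstep'
    exact ((hφ₀.joined_of_isStep hf₀.isStep hstep ht₀ hu₀).trans
      (hJ ε hε (hεδ.trans_le (min_le_left _ _)) u₀ u₁ hu₀
        fun x => (hu₁ x).trans (twistMap_reverse hs hφx hT x).symm)).trans
      (hφ₁.joined_of_isStep hstep' hf₁.isStep hu₁ ht₁)

end

/-! ### The Dehn quandle and its augmentation -/

section

variable {S : Type*} [TopologicalSpace S] [ChartedSpace ℂ S]

theorem exists_positive_twist [T2Space S] [IsManifold 𝓘(ℝ, ℂ) ∞ S]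
    {φ : OpenPartialHomeomorph S ℂ} {c : SimpleClosedCurve S} (hφ : IsBicollar φ c) {f : ℝ → ℝ}
    (hf : IsTwistProfile f) :
    ∃ t : OrientedDiffeo S, (∀ x, t x = twistMap φ f x) ∧
      ∀ x, t⁻¹ x = twistMap φ (fun r => -f r) x := by
  obtain ⟨a, b, hT, -⟩ := hφ.exists_isTwistable hf.isStep hf.isStep
  exact ⟨hT.diffeo hφ.isOrientedChart, fun _ => rfl, fun _ => rfl⟩

theorem SimpleClosedCurve.exists_twists [T2Space S] [SecondCountableTopology S]
    [OrientedSurface S] (c : SimpleClosedCurve S) :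
    ∃ t : OrientedDiffeo S, IsPositiveDehnTwist t c ∧ IsNegativeDehnTwist t⁻¹ c := by
  obtain ⟨φ, hφ⟩ := c.exists_isBicollar
  have hs := isStep_thinProfile (ε := 1 / 4) (by norm_num) (by norm_num)
  have hf : IsTwistProfile (thinProfile (1 / 4)) := ⟨contDiff_thinProfile _, hs.eq_one, hs.eq_two⟩
  obtain ⟨t, h1, h2⟩ := exists_positive_twist hφ hf
  exact ⟨t, ⟨φ, _, hφ, hf, h1⟩, ⟨φ, _, hφ, hf, h2⟩⟩

theorem IsNegativeDehnTwist.inv [T2Space S] [IsManifold 𝓘(ℝ, ℂ) ∞ S] {t : OrientedDiffeo S}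
    {c : SimpleClosedCurve S} (h : IsNegativeDehnTwist t c) : IsPositiveDehnTwist t⁻¹ c := by
  obtain ⟨φ, f, hφ, hf, ht⟩ := h
  obtain ⟨u, h1, h2⟩ := exists_positive_twist hφ hf
  have : t = u⁻¹ := OrientedDiffeo.ext' fun x => (ht x).trans (h2 x).symm
  exact ⟨φ, f, hφ, hf, by rwa [this, inv_inv]⟩

theorem twistMap_mem_carrier {φ : OpenPartialHomeomorph S ℂ} {c : SimpleClosedCurve S}
    (hφ : IsBicollar φ c) (f : ℝ → ℝ) {x : S} (hx : x ∈ c.carrier) :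
    twistMap φ f x ∈ c.carrier := by
  have h1 : φ x ∈ {z : ℂ | ‖z‖ = 3 / 2} := hφ.image_eq ▸ mem_image_of_mem φ hx
  have h2 : radialRotation f (φ x) ∈ {z : ℂ | ‖z‖ = 3 / 2} := by
    rw [mem_ofPred_eq, norm_radialRotation]; exact h1
  rw [← hφ.image_eq] at h2
  obtain ⟨y, hy, hyx⟩ := h2
  rw [twistMap_of_mem x (hφ.subset_source hx), ← hyx, φ.left_inv (hφ.subset_source hy)]
  exact hy

/-- A Dehn twist about `c` preserves `c`. -/
theorem IsPositiveDehnTwist.map_self [T2Space S] [IsManifold 𝓘(ℝ, ℂ) ∞ S] {t : OrientedDiffeo S}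
    {c : SimpleClosedCurve S} (h : IsPositiveDehnTwist t c) : c.map t = c := by
  obtain ⟨φ, f, hφ, hf, ht⟩ := h
  obtain ⟨u, h1, h2⟩ := exists_positive_twist hφ hf
  obtain rfl : t = u := OrientedDiffeo.ext' fun x => (ht x).trans (h1 x).symm
  refine SimpleClosedCurve.ext' (Subset.antisymm ?_ fun x hx => ?_)
  · rintro _ ⟨x, hx, rfl⟩
    rw [ht]
    exact twistMap_mem_carrier hφ f hx
  · refine ⟨t⁻¹ x, ?_, ?_⟩
    · rw [h2]; exact twistMap_mem_carrier hφ _ hx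
    · rw [← OrientedDiffeo.mul_apply, mul_inv_cancel, OrientedDiffeo.one_apply]

/-- Conjugates of Dehn twists are Dehn twists about the image curves. -/
theorem IsPositiveDehnTwist.conj [IsManifold 𝓘(ℝ, ℂ) ∞ S] {t : OrientedDiffeo S}
    {c : SimpleClosedCurve S} (ht : IsPositiveDehnTwist t c) (h : OrientedDiffeo S) :
    IsPositiveDehnTwist (h * t * h⁻¹) (c.map h) := by
  obtain ⟨φ, f, hφ, hf, ht⟩ := ht
  -- The collar of the image curve is φ ∘ h⁻¹, with the same annulus and the same profile.
  let φ' : OpenPartialHomeomorph S ℂ :=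
    h.toDiffeo.symm.toHomeomorph.transOpenPartialHomeomorph φ
  have hsrc {x : S} : x ∈ φ'.source ↔ h⁻¹ x ∈ φ.source := Iff.rfl
  have happ (x : S) : φ' x = φ (h⁻¹ x) := rfl
  have hsymm (z : ℂ) : φ'.symm z = h (φ.symm z) := rfl
  have htgt : φ'.target = φ.target := rfl
  have hself (x : S) : h⁻¹ (h x) = x := h.inv_apply_self x
  have hself' (x : S) : h (h⁻¹ x) = x := by
    rw [← OrientedDiffeo.mul_apply, mul_inv_cancel, OrientedDiffeo.one_apply]
  refine ⟨φ', f, ⟨hφ.target_eq, ?_, ?_, fun x hx => ?_, ?_, ?_⟩, hf, fun x => ?_⟩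
  · exact hφ.smooth.comp h.toDiffeo.symm.contMDiff.contMDiffOn fun x hx => hx
  · exact h.toDiffeo.contMDiff.comp_contMDiffOn hφ.smooth_symm
  · have k1 : MDifferentiableAt 𝓘(ℝ, ℂ) 𝓘(ℝ, ℂ) φ (h⁻¹ x) :=
      (hφ.smooth.contMDiffAt (φ.open_source.mem_nhds hx)).mdifferentiableAt (by simp)
    have k2 := OrientedDiffeo.mdifferentiable (h⁻¹).toDiffeo x
    have k3 : surfaceJacobian φ' x = surfaceJacobian φ (h⁻¹ x) * surfaceJacobian (h⁻¹).toDiffeo x :=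
      surfaceJacobian_comp (f := φ) (g := (h⁻¹).toDiffeo) k1 k2
    rw [k3]
    exact mul_pos (hφ.jacobian_pos _ hx) (h⁻¹.jacobian_pos x)
  · rintro _ ⟨x, hx, rfl⟩
    rw [hsrc, hself]
    exact hφ.subset_source hx
  · rw [← hφ.image_eq]
    change φ' '' (h '' c.carrier) = _
    rw [image_image]
    exact image_congr fun x _ => by rw [happ, hself]
  · rw [OrientedDiffeo.mul_apply, OrientedDiffeo.mul_apply, ht]
    by_cases hx : x ∈ φ'.source
    · rw [twistMap_of_mem _ hx, twistMap_of_mem _ (hsrc.1 hx), hsymm, happ]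
    · rw [twistMap_of_notMem _ hx, twistMap_of_notMem _ (fun k => hx (hsrc.2 k)), hself']

namespace MappingClassGroup

theorem mk_inv (f : OrientedDiffeo S) : mk f⁻¹ = (mk f)⁻¹ := rfl

theorem mk_eq_mk {f g : OrientedDiffeo S} (h : Joined f g) : mk f = mk g := Quotient.sound h

theorem mk_surjective : Function.Surjective (mk : OrientedDiffeo S → MappingClassGroup S) :=
  Quotient.mk_surjective

end MappingClassGroup

theorem DehnQuandle.mk_surjective :
    Function.Surjective (DehnQuandle.mk : SimpleClosedCurve S → DehnQuandle S) :=
  Quotient.mk_surjective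

/-- The mapping class group acts on isotopy classes of curves. -/
instance : MulAction (MappingClassGroup S) (DehnQuandle S) where
  smul := Quotient.map₂ (fun h c => c.map h) fun f g hfg c d ⟨k, hk, hcd⟩ => by
    -- This carries f(c) to c, then to d, then to g(d). It is isotopic to f f⁻¹ = 1 because f is
    -- joined to g and k to 1.
    refine ⟨g * k * f⁻¹, ?_, ?_⟩
    · have := OrientedDiffeo.joined_mul (OrientedDiffeo.joined_mul hfg hk)
        (Joined.refl f⁻¹)
      simpa using this
    · rw [SimpleClosedCurve.map_mul, SimpleClosedCurve.map_mul,
        ← SimpleClosedCurve.map_mul f⁻¹ f, inv_mul_cancel, SimpleClosedCurve.map_one, hcd]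
  one_smul := by
    rintro ⟨c⟩
    exact congrArg DehnQuandle.mk (SimpleClosedCurve.map_one c)
  mul_smul := by
    rintro ⟨f⟩ ⟨g⟩ ⟨c⟩
    exact congrArg DehnQuandle.mk (SimpleClosedCurve.map_mul f g c)

theorem mk_smul_mk (h : OrientedDiffeo S) (c : SimpleClosedCurve S) :
    MappingClassGroup.mk h • DehnQuandle.mk c = DehnQuandle.mk (c.map h) := rfl

section Twist

variable [T2Space S] [SecondCountableTopology S] [OrientedSurface S]

/-- The mapping class of the positive Dehn twists about the curves of an isotopy class. -/
def twistClass : DehnQuandle S → MappingClassGroup S :=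
  Quotient.lift (fun c => MappingClassGroup.mk c.exists_twists.choose) (by
    rintro c d ⟨h, hj, rfl⟩
    have h1 := c.exists_twists.choose_spec.1
    have h2 := (c.map h).exists_twists.choose_spec.1
    refine MappingClassGroup.mk_eq_mk (Joined.trans ?_ (joined_of_isPositiveDehnTwist (h1.conj h) h2))
    -- As h is joined to the identity, the conjugate h t h⁻¹, a twist about h(c), is joined to t.
    simpa using OrientedDiffeo.joined_mul (OrientedDiffeo.joined_mul hj
      (Joined.refl c.exists_twists.choose)) (OrientedDiffeo.joined_inv hj))

theorem twistClass_mk {c : SimpleClosedCurve S} {t : OrientedDiffeo S}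
    (ht : IsPositiveDehnTwist t c) : twistClass (DehnQuandle.mk c) = MappingClassGroup.mk t :=
  MappingClassGroup.mk_eq_mk
    (joined_of_isPositiveDehnTwist c.exists_twists.choose_spec.1 ht)

/-- Conjugating a twist about c gives a twist about the image curve, and every such twist represents
its class. Self-distributivity and the augmentation identity are instances of this. -/
theorem twistClass_smul (g : MappingClassGroup S) (q : DehnQuandle S) :
    twistClass (g • q) = g * twistClass q * g⁻¹ := by
  obtain ⟨h, rfl⟩ := MappingClassGroup.mk_surjective g
  obtain ⟨c, rfl⟩ := DehnQuandle.mk_surjective q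
  obtain ⟨t, ht, -⟩ := c.exists_twists
  rw [mk_smul_mk, twistClass_mk ht, twistClass_mk (ht.conj h)]
  rfl

theorem twistClass_smul_self (q : DehnQuandle S) : twistClass q • q = q := by
  obtain ⟨c, rfl⟩ := DehnQuandle.mk_surjective q
  obtain ⟨t, ht, -⟩ := c.exists_twists
  rw [twistClass_mk ht, mk_smul_mk, ht.map_self]

/-- The Dehn quandle of a surface. -/
instance : Quandle (DehnQuandle S) where
  act x y := twistClass x • y
  invAct x y := (twistClass x)⁻¹ • y
  self_distrib {x y z} := by
    rw [twistClass_smul, smul_smul, smul_smul, inv_mul_cancel_right]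
  left_inv x y := inv_smul_smul _ _
  right_inv x y := smul_inv_smul _ _
  fix {x} := twistClass_smul_self x

theorem DehnQuandle.act_def (x y : DehnQuandle S) : x ◃ y = twistClass x • y := rfl

theorem DehnQuandle.invAct_def (x y : DehnQuandle S) : x ◃⁻¹ y = (twistClass x)⁻¹ • y := rfl

/-- Passing to the opposite group turns the left action into a right action, and g t g⁻¹ becomes the
conjugate with the inverse on the left. -/
theorem isAugmentedQuandle_dehnQuandle :
    IsAugmentedQuandle (DehnQuandle S) (MappingClassGroup S)ᵐᵒᵖ
      (fun q => MulOpposite.op (twistClass q)) (fun q g => g.unop • q) where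
  act_one q := one_smul _ q
  act_mul q g h := by rw [MulOpposite.unop_mul, mul_smul]
  act_hom x y g := by
    rw [DehnQuandle.act_def, DehnQuandle.act_def, twistClass_smul, smul_smul, smul_smul,
      inv_mul_cancel_right]
  act_hom_inv x y g := by
    rw [DehnQuandle.invAct_def, DehnQuandle.invAct_def, twistClass_smul, smul_smul, smul_smul]
    congr 1
    group
  act_self q := twistClass_smul_self q
  aug_act q g := by
    apply MulOpposite.unop_injective
    simp only [MulOpposite.unop_op, MulOpposite.unop_mul, MulOpposite.unop_inv, twistClass_smul,
      mul_assoc]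

end Twist

end

end

theorem proposition16 (S : Type*) [TopologicalSpace S] [T2Space S] [SecondCountableTopology S]
    [ChartedSpace ℂ S] [OrientedSurface S] :
    -- every simple closed curve has positive and negative Dehn twists
    (∀ c : SimpleClosedCurve S,
      (∃ t, IsPositiveDehnTwist t c) ∧ ∃ t, IsNegativeDehnTwist t c) ∧
    ∃ (_ : Quandle (DehnQuandle S)) (ℓ : DehnQuandle S → MappingClassGroup S)
      (act : DehnQuandle S → MappingClassGroup S → DehnQuandle S),
      -- the quandle operations are induced by the positive and the negative Dehn twists
      (∀ (x y : SimpleClosedCurve S) (t : OrientedDiffeo S), IsPositiveDehnTwist t y →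
        DehnQuandle.mk y ◃ DehnQuandle.mk x = DehnQuandle.mk (x.map t)) ∧
      (∀ (x y : SimpleClosedCurve S) (t : OrientedDiffeo S), IsNegativeDehnTwist t y →
        DehnQuandle.mk y ◃⁻¹ DehnQuandle.mk x = DehnQuandle.mk (x.map t)) ∧
      -- the action is `[q] · [h] = [h(q)]`
      (∀ (q : SimpleClosedCurve S) (h : OrientedDiffeo S),
        act (DehnQuandle.mk q) (MappingClassGroup.mk h) = DehnQuandle.mk (q.map h)) ∧
      -- `ℓ` sends the class of a curve to the class of any positive Dehn twist about it
      (∀ (c : SimpleClosedCurve S) (t : OrientedDiffeo S), IsPositiveDehnTwist t c →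
        ℓ (DehnQuandle.mk c) = MappingClassGroup.mk t) ∧
      -- augmented quandle; for the right action, products in the mapping class group are read from
      -- left to right, which gives the opposite of the group with products `[f] * [g] = [f ∘ g]`
      IsAugmentedQuandle (DehnQuandle S) (MappingClassGroup S)ᵐᵒᵖ
        (fun q => MulOpposite.op (ℓ q)) (fun q g => act q g.unop) ∧
      -- `t_{h(c)} = h t_c h⁻¹`
      (∀ (c : SimpleClosedCurve S) (h : OrientedDiffeo S),
        ℓ (DehnQuandle.mk (c.map h)) =
        MappingClassGroup.mk h * ℓ (DehnQuandle.mk c) * (MappingClassGroup.mk h)⁻¹) := by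
  refine ⟨fun c => ?_, inferInstance, twistClass, fun q g => g • q, fun x y t ht => ?_,
    fun x y t ht => ?_, fun _ _ => rfl, fun c t ht => twistClass_mk ht,
    isAugmentedQuandle_dehnQuandle, fun c h => ?_⟩
  · obtain ⟨t, h1, h2⟩ := c.exists_twists
    exact ⟨⟨t, h1⟩, ⟨t⁻¹, h2⟩⟩
  · rw [DehnQuandle.act_def, twistClass_mk ht, mk_smul_mk]
  · rw [DehnQuandle.invAct_def, twistClass_mk ht.inv, MappingClassGroup.mk_inv, inv_inv,
      mk_smul_mk]
  · rw [← mk_smul_mk, twistClass_smul]
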